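/- Let $(\mathcal H_\alpha)_\alpha$ be a family of complex Hilbert spaces and let $\mathcal P=\bigsqcup_\alpha\mathbb P\mathcal H_\alpha$ be the disjoint union of their projective spaces, with transition probabilities $p(\rho,\sigma)=|(\Omega_\rho,\Omega_\sigma)|^2$ if $\rho,\sigma$ lie in the same $\mathbb P\mathcal H_\alpha$ ($\Omega_\rho,\Omega_\sigma$ being unit vectors in the rays $\rho,\sigma$), and $p(\rho,\sigma)=0$ otherwise. Put $p_\rho(\sigma)=p(\rho,\sigma)$. Let $\mathfrak A_{00}(\mathcal P)\subset\ell^\infty(\mathcal P)$ be the space of finite real linear combinations of the functions $p_\rho$ ($\ell^\infty(\mathcal P)$ being the bounded real functions with the sup-norm), $\mathfrak A_0(\mathcal P)$ its norm closure, and $\mathfrak A(\mathcal P)=\mathfrak A_0(\mathcal P)^{**}$. For $Q\subseteq\mathcal P$ put $Q^\perp=\{\sigma\in\mathcal P: p(\rho,\sigma)=0\ \forall\rho\in Q\}$; $Q$ is orthoclosed if $Q=Q^{\perp\perp}$. A basis of $Q$ is a subset $B\subseteq Q$ such that $p(e,e')=0$ for distinct $e,e'\in B$ and $\sum_{e\in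 B}p(e,\sigma)=1$ for all $\sigma\in Q$. Every orthoclosed $Q$ has a basis, and the function $p_Q=\sum_{e\in B}p_e$ does not depend on the choice of the basis $B$ of $Q$. A spectral resolution of a function $f$ on $\mathcal P$ is a pointwise convergent expansion $f=\sum_j\lambda_jp_{Q_j}$ with $\lambda_j\in\mathbb R$ and $(Q_j)$ a mutually orthogonal family of orthoclosed sets such that $\sum_jp_{Q_j}=1$ pointwise. Then: 1. Each $f\in\mathfrak A_{00}(\mathcal P)$ has a spectral resolution $f=\sum_j\lambda_jp_{Q_j}$; the function $f^2:=\sum_j\lambda_j^2p_{Q_j}$ (pointwise convergent) does not depend on the choice of the resolution and lies in $\mathfrak A_{00}(\mathcal P)$. The product $f\circ g=\frac14\bigl((f+g)^2-(f-g)^2\bigr)$ makes $\mathfrak A_{00}(\mathcal P)$ a Jordan algebra, that is, $\circ$ is bilinear and symmetric and $(f\circ f)\circ(f\circ g)=f\circ((f\circ f)\circ g)$; moreover $f\circ f=f^2$. 2. There is a unique norm-continuous map $\circ:\mathfrak A_0(\mathcal P)\times\mathfrak A_0(\mathcal P)\to\mathfrak A_0(\mathcal P)$ extending the product of 1, and it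 makes $\mathfrak A_0(\mathcal P)$, with the sup-norm, a JB-algebra, that is, a Jordan algebra which is a Banach space with $\|a\circ b\|\le\|a\|\,\|b\|$, $\|a\circ a\|=\|a\|^2$ and $\|a\circ a\|\le\|a\circ a+b\circ b\|$ for all $a,b$. 3. There is a unique map $\circ:\mathfrak A(\mathcal P)\times\mathfrak A(\mathcal P)\to\mathfrak A(\mathcal P)$ which is $w^*$-continuous in each variable separately and extends the product of 2 along the canonical embedding $\mathfrak A_0(\mathcal P)\subset\mathfrak A_0(\mathcal P)^{**}$, and it makes $\mathfrak A(\mathcal P)$, with the bidual norm, a JB-algebra. -/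

import Mathlib

set_option maxSynthPendingDepth 3

noncomputable section

namespace TPS

/-- A transition probability on a set `P`: a function `p : P × P → [0,1]` with
`p ρ σ = 0 ↔ p σ ρ = 0` and `p ρ σ = 1 ↔ ρ = σ`. -/
structure TransitionProbability (P : Type*) where
  prob : P → P → ℝ
  nonneg : ∀ ρ σ, 0 ≤ prob ρ σ
  le_one : ∀ ρ σ, prob ρ σ ≤ 1
  eq_zero_comm : ∀ ρ σ, prob ρ σ = 0 ↔ prob σ ρ = 0
  eq_one_iff : ∀ ρ σ, prob ρ σ = 1 ↔ ρ = σ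

namespace TransitionProbability

variable {P : Type*} (p : TransitionProbability P)

/-- Orthogonal subsets of `P`. -/
def IsOrthogonal (S : Set P) : Prop :=
  ∀ ρ ∈ S, ∀ σ ∈ S, ρ ≠ σ → p.prob ρ σ = 0

/-- The orthoplement of a subset of `P`. -/
def orthoplement (Q : Set P) : Set P :=
  {σ | ∀ ρ ∈ Q, p.prob ρ σ = 0}

/-- Orthoclosed subsets: those equal to their double orthoplement. -/
def IsOrthoclosed (Q : Set P) : Prop :=
  p.orthoplement (p.orthoplement Q) = Q

/-- `B` is a basis of the subset `Q`: an orthogonal subset of `Q` whose transition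
probabilities to each point of `Q` add up to one. -/
structure IsBasisOf (B Q : Set P) : Prop where
  subset : B ⊆ Q
  orthogonal : p.IsOrthogonal B
  hasSum_one : ∀ σ ∈ Q, HasSum (fun e : B => p.prob e σ) 1

open Classical in
/-- The function `p_Q = ∑_{e ∈ B} p_e`, where `B` is a basis of `Q` (and zero if `Q` happens to
have no basis). -/
def probSet (Q : Set P) (σ : P) : ℝ :=
  if h : ∃ B, p.IsBasisOf B Q then ∑' e : h.choose, p.prob e σ else 0

/-- A spectral resolution of `f`: an expansion `f = ∑_j lam_j p_{Q_j}`, converging pointwise,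
where the `Q_j` form an orthogonal family of orthoclosed sets such that `∑_j p_{Q_j}` is the unit
function. -/
structure IsSpectralResolution (f : P → ℝ) {J : Type*} (lam : J → ℝ) (Q : J → Set P) : Prop where
  orthoclosed : ∀ j, p.IsOrthoclosed (Q j)
  orthogonal : ∀ i j, i ≠ j → ∀ ρ ∈ Q i, ∀ σ ∈ Q j, p.prob ρ σ = 0
  hasSum_one : ∀ σ, HasSum (fun j => p.probSet (Q j) σ) 1
  hasSum : ∀ σ, HasSum (fun j => lam j * p.probSet (Q j) σ) (f σ)

/-- The element `p_ρ` of `ℓ^∞(P)`, given by `p_ρ σ = p ρ σ`. -/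
def probVec (ρ : P) : lp (fun _ : P => ℝ) ⊤ :=
  ⟨p.prob ρ, memℓp_infty ⟨1, by
    rintro _ ⟨σ, rfl⟩
    simpa [abs_of_nonneg (p.nonneg ρ σ)] using p.le_one ρ σ⟩⟩

@[simp] theorem probVec_apply (ρ σ : P) : p.probVec ρ σ = p.prob ρ σ := rfl

/-- `𝔄₀₀(P)`: finite real linear combinations of the functions `p_ρ`, inside `ℓ^∞(P)` with the
sup-norm. -/
abbrev A00 : Submodule ℝ (lp (fun _ : P => ℝ) ⊤) :=
  Submodule.span ℝ (Set.range p.probVec)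

/-- `𝔄₀(P)`: the norm closure of `𝔄₀₀(P)` in `ℓ^∞(P)`. -/
abbrev A0 : Submodule ℝ (lp (fun _ : P => ℝ) ⊤) :=
  p.A00.topologicalClosure

/-- The inclusion of `𝔄₀₀(P)` in `𝔄₀(P)`. -/
def inclA0 : p.A00 →ₗ[ℝ] p.A0 :=
  Submodule.inclusion p.A00.le_topologicalClosure

/-- `𝔄(P)`: the double dual of the Banach space `𝔄₀(P)`. -/
abbrev ABidual : Type _ := StrongDual ℝ (StrongDual ℝ p.A0)

/-- The canonical embedding of `𝔄₀(P)` in its double dual. -/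
def inclBidual : p.A0 →L[ℝ] p.ABidual :=
  NormedSpace.inclusionInDoubleDual ℝ p.A0

end TransitionProbability

/-- `mul` turns the real vector space `V` into a Jordan algebra: it is bilinear, symmetric, and
`a² ∘ (a ∘ b) = a ∘ (a² ∘ b)`. -/
structure IsJordanProduct {V : Type*} [AddCommGroup V] [Module ℝ V] (mul : V → V → V) : Prop where
  add_left : ∀ a b c, mul (a + b) c = mul a c + mul b c
  smul_left : ∀ (t : ℝ) a b, mul (t • a) b = t • mul a b
  comm : ∀ a b, mul a b = mul b a
  jordan : ∀ a b, mul (mul a a) (mul a b) = mul a (mul (mul a a) b)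

/-- `mul` turns the real normed space `V` into a JB-algebra. -/
structure IsJBProduct {V : Type*} [NormedAddCommGroup V] [NormedSpace ℝ V]
    (mul : V → V → V) : Prop extends IsJordanProduct mul where
  complete : CompleteSpace V
  norm_mul_le : ∀ a b, ‖mul a b‖ ≤ ‖a‖ * ‖b‖
  norm_sq : ∀ a, ‖mul a a‖ = ‖a‖ ^ 2
  norm_sq_le : ∀ a b, ‖mul a a‖ ≤ ‖mul a a + mul b b‖

/-- Continuity of a self-map of a dual space for the weak-star topology on both sides. -/
def WeakStarContinuous {E : Type*} [NormedAddCommGroup E] [NormedSpace ℝ E]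
    (T : StrongDual ℝ E → StrongDual ℝ E) : Prop :=
  Continuous fun x : WeakDual ℝ E => StrongDual.toWeakDual (T (WeakDual.toStrongDual x))

/-- Weak-star continuity in each variable separately. -/
def SeparatelyWeakStarContinuous {E : Type*} [NormedAddCommGroup E] [NormedSpace ℝ E]
    (mul : StrongDual ℝ E → StrongDual ℝ E → StrongDual ℝ E) : Prop :=
  (∀ x, WeakStarContinuous fun y => mul x y) ∧ ∀ y, WeakStarContinuous fun x => mul x y

section Hilbert

/-- The transition probability `|(Ω_x, Ω_y)|²` between two rays, with `Ω_x`, `Ω_y` unit vectors in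
these rays. -/
def rayProb {H : Type*} [NormedAddCommGroup H] [InnerProductSpace ℂ H]
    (x y : Projectivization ℂ H) : ℝ :=
  (‖inner ℂ x.rep y.rep‖ / (‖x.rep‖ * ‖y.rep‖)) ^ 2

theorem rayProb_mk {H : Type*} [NormedAddCommGroup H] [InnerProductSpace ℂ H]
    (v w : H) (hv : v ≠ 0) (hw : w ≠ 0) :
    rayProb (Projectivization.mk ℂ v hv) (Projectivization.mk ℂ w hw) =
      (‖inner ℂ v w‖ / (‖v‖ * ‖w‖)) ^ 2 := by
  obtain ⟨a, ha⟩ := Projectivization.exists_smul_eq_mk_rep ℂ v hv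
  obtain ⟨b, hb⟩ := Projectivization.exists_smul_eq_mk_rep ℂ w hw
  have ha0 : ‖(a : ℂ)‖ ≠ 0 := norm_ne_zero_iff.2 a.ne_zero
  have hb0 : ‖(b : ℂ)‖ ≠ 0 := norm_ne_zero_iff.2 b.ne_zero
  have hv0 : ‖v‖ ≠ 0 := norm_ne_zero_iff.2 hv
  have hw0 : ‖w‖ ≠ 0 := norm_ne_zero_iff.2 hw
  rw [rayProb, ← ha, ← hb]
  simp only [Units.smul_def, inner_smul_left, inner_smul_right, norm_smul, norm_mul,
    RCLike.norm_conj]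
  congr 1
  field_simp

theorem rayProb_mk_of_norm_eq_one {H : Type*} [NormedAddCommGroup H] [InnerProductSpace ℂ H]
    (v w : H) (hv : v ≠ 0) (hw : w ≠ 0) (hv1 : ‖v‖ = 1) (hw1 : ‖w‖ = 1) :
    rayProb (Projectivization.mk ℂ v hv) (Projectivization.mk ℂ w hw) = ‖inner ℂ v w‖ ^ 2 := by
  rw [rayProb_mk, hv1, hw1, mul_one, div_one]

theorem rayProb_nonneg {H : Type*} [NormedAddCommGroup H] [InnerProductSpace ℂ H]
    (x y : Projectivization ℂ H) : 0 ≤ rayProb x y := sq_nonneg _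

theorem rayProb_le_one {H : Type*} [NormedAddCommGroup H] [InnerProductSpace ℂ H]
    (x y : Projectivization ℂ H) : rayProb x y ≤ 1 := by
  refine pow_le_one₀ (by positivity) (div_le_one_of_le₀ (norm_inner_le_norm _ _) (by positivity))

theorem rayProb_comm {H : Type*} [NormedAddCommGroup H] [InnerProductSpace ℂ H]
    (x y : Projectivization ℂ H) : rayProb x y = rayProb y x := by
  rw [rayProb, rayProb, norm_inner_symm, mul_comm ‖x.rep‖]

theorem rayProb_eq_one_iff {H : Type*} [NormedAddCommGroup H] [InnerProductSpace ℂ H]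
    (x y : Projectivization ℂ H) : rayProb x y = 1 ↔ x = y := by
  have hx := x.rep_nonzero
  have hy := y.rep_nonzero
  have hn : ‖x.rep‖ * ‖y.rep‖ ≠ 0 := mul_ne_zero (norm_ne_zero_iff.2 hx) (norm_ne_zero_iff.2 hy)
  rw [rayProb, pow_eq_one_iff_of_nonneg (by positivity) two_ne_zero, div_eq_one_iff_eq hn,
    norm_inner_eq_norm_iff hx hy]
  constructor
  · rintro ⟨r, -, h⟩
    rw [← x.mk_rep, ← y.mk_rep]
    exact ((Projectivization.mk_eq_mk_iff' ℂ _ _ hy hx).2 ⟨r, h.symm⟩).symm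
  · rintro rfl
    exact ⟨1, one_ne_zero, (one_smul ℂ _).symm⟩

/-- The disjoint union of the projective Hilbert spaces `ℙ H_α`. -/
abbrev PureStates {ι : Type*} (H : ι → Type*) [∀ α, NormedAddCommGroup (H α)]
    [∀ α, InnerProductSpace ℂ (H α)] : Type _ :=
  Σ α, Projectivization ℂ (H α)

open Classical in
/-- The transition probabilities on the disjoint union of the `ℙ H_α`: those of rays inside each
`ℙ H_α`, and zero between different ones. -/
def pureProb {ι : Type*} (H : ι → Type*) [∀ α, NormedAddCommGroup (H α)]
    [∀ α, InnerProductSpace ℂ (H α)] : TransitionProbability (PureStates H) where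
  prob ρ σ := if h : σ.1 = ρ.1 then rayProb ρ.2 (h ▸ σ.2) else 0
  nonneg ρ σ := by
    split_ifs
    · exact rayProb_nonneg _ _
    · exact le_rfl
  le_one ρ σ := by
    split_ifs
    · exact rayProb_le_one _ _
    · exact zero_le_one
  eq_zero_comm := by
    rintro ⟨α, x⟩ ⟨β, y⟩
    by_cases h : β = α
    · subst h
      simp [rayProb_comm x y]
    · simp [h, Ne.symm h]
  eq_one_iff := by
    rintro ⟨α, x⟩ ⟨β, y⟩
    by_cases h : β = α
    · subst h
      simp [rayProb_eq_one_iff]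
    · simp [h, Ne.symm h]

theorem pureProb_same {ι : Type*} (H : ι → Type*) [∀ α, NormedAddCommGroup (H α)]
    [∀ α, InnerProductSpace ℂ (H α)] (α : ι) (x y : Projectivization ℂ (H α)) :
    (pureProb H).prob ⟨α, x⟩ ⟨α, y⟩ = rayProb x y := by
  simp [pureProb]

theorem pureProb_of_ne {ι : Type*} (H : ι → Type*) [∀ α, NormedAddCommGroup (H α)]
    [∀ α, InnerProductSpace ℂ (H α)] {α β : ι} (h : α ≠ β)
    (x : Projectivization ℂ (H α)) (y : Projectivization ℂ (H β)) :
    (pureProb H).prob ⟨α, x⟩ ⟨β, y⟩ = 0 := by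
  simp [pureProb, h.symm]

end Hilbert

end TPS

end

/-!
A function in `𝔄₀₀` is the function `ℂΩ ↦ ⟨Ω, TΩ⟩` (`Ω` a unit vector) of a family `T` of
self-adjoint operators on the Hilbert spaces `H α`, of finite rank and zero for almost all `α`. All
products of the theorem are the operator product `(ST + TS)/2`, read off in this way.

The functions of bounded families of self-adjoint operators form a subspace `opSpace` of the bounded
functions, with product `jmul`. The value of `f ∘ g` at `ℂΩ` is `Re ⟨SΩ, TΩ⟩`, that of `f ∘ f` is
`‖TΩ‖²`, so that the norm axioms of a JB-algebra can be checked pointwise, and the Jordan identity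
is inherited from the associative product of operators. A bounded function lies in `opSpace` if and
only if its homogeneous extension `quad f α` to each `H α` satisfies the linear identities of a
quadratic form (`mem_opSpace_iff`); hence `opSpace` is closed under bounded pointwise limits, and
contains `𝔄₀`. Finite rank operators being an ideal, `𝔄₀₀` and `𝔄₀` are closed under `jmul`.

Orthoclosed sets are the sets of rays in families of closed subspaces, and `p_Q` is the function of
the projections on these subspaces. The spectral theorem for compact operators gives the spectral
resolutions. Conversely, for any resolution of `f`, polarization shows that the subspaces
consist of eigenvectors of the operators of `f` (`hasSum_sq_of_isSpectralResolution`), so that the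
square defined by the resolution is that of the operators.

The bidual of `𝔄₀` is `opSpace`, by evaluation of its elements at the functionals `f ↦ f(σ)`. This
is onto, since compressions `eTe` by finite rank projections `e` lie in `𝔄₀₀` and have a weak-star
cluster point in the bidual. It is injective, since these functionals span a norm dense subspace of
the dual (`dense_span_quadDual`): a functional which almost attains its norm at `a = eae` is small
outside the corner `e𝔄₀e`, as `‖a + t(b - ebe)‖ ≤ 1 + 2t²` for `‖a‖, ‖b‖ ≤ 1`, and on
this finite-dimensional corner it is a combination of evaluations. The product is carried over by
this isometry. Multiplication by an element is the adjoint of a map on the dual of `𝔄₀`, as can be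
checked on evaluations (`exists_predual_bidualMul`), which makes it weak-star continuous. Uniqueness
holds as `𝔄₀` is weak-star dense.
-/

noncomputable section

namespace TPS

open Complex QuadraticMap

/-! ### Operators from quadratic forms -/

section Riesz

variable {E : Type*} [NormedAddCommGroup E] [InnerProductSpace ℂ E] [CompleteSpace E]

/-- A bounded complex-homogeneous function on a Hilbert space that satisfies the algebraic
identities of a real quadratic form is the quadratic form of a bounded operator. -/
theorem exists_clm_of_polar (q : E → ℝ) (C : ℝ) (hC : ∀ v, |q v| ≤ C * ‖v‖ ^ 2)
    (hsmul : ∀ (c : ℂ) v, q (c • v) = ‖c‖ ^ 2 * q v)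
    (hadd : ∀ u v w, polar q (u + v) w = polar q u w + polar q v w)
    (hreal : ∀ (t : ℝ) u v, polar q ((t : ℂ) • u) v = t * polar q u v) :
    ∃ T : E →L[ℂ] E, ∀ v, inner ℂ v (T v) = (q v : ℂ) := by
  have hsymm : ∀ u v, polar q u v = polar q v u := polar_comm q
  have hadd' : ∀ u v w, polar q u (v + w) = polar q u v + polar q u w := fun u v w => by
    rw [hsymm, hadd, hsymm v, hsymm w]
  have hreal' : ∀ (t : ℝ) u v, polar q u ((t : ℂ) • v) = t * polar q u v := fun t u v => by
    rw [hsymm, hreal, hsymm v]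
  have hI : ∀ u v, polar q (I • u) (I • v) = polar q u v := fun u v => by
    simp only [polar, ← smul_add, hsmul, norm_I]; ring
  have hneg : ∀ u v, polar q (-u) v = -polar q u v := fun u v => by
    have := hreal (-1) u v
    simpa using this
  have hI' : ∀ u v, polar q (I • u) v = -polar q u (I • v) := fun u v => by
    rw [← hI, smul_smul, I_mul_I, neg_one_smul, hneg]
  have hself : ∀ v, polar q v v = 2 * q v := fun v => by
    have h2 := hsmul 2 v
    rw [two_smul, norm_ofNat] at h2
    rw [polar, h2]; ring
  have hqneg : ∀ v, q (-v) = q v := fun v => by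
    have := hsmul (-1) v
    simpa using this
  -- From `2 polar q u v = q (u + v) - q (u - v)` and the parallelogram law.
  have hb1 : ∀ u v, |polar q u v| ≤ C * (‖u‖ ^ 2 + ‖v‖ ^ 2) := fun u v => by
    have h1 := hneg u v
    have h2 : 2 * polar q u v = q (u + v) - q (-u + v) := by
      rw [two_mul]
      nth_rw 2 [show polar q u v = -polar q (-u) v by rw [h1, neg_neg]]
      simp only [polar, hqneg]; ring
    have h3 := parallelogram_law_with_norm ℂ v u
    have h4 := hC (u + v)
    have h5 := hC (-u + v)
    rw [show -u + v = v - u by abel] at h2 h5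
    rw [add_comm u v] at h2 h4
    rw [abs_le] at h4 h5 ⊢
    have h7 : C * ‖v + u‖ ^ 2 + C * ‖v - u‖ ^ 2 = 2 * (C * (‖u‖ ^ 2 + ‖v‖ ^ 2)) := by
      rw [← mul_add, h3]; ring
    constructor <;> linarith
  -- Rescaling to unit vectors turns the bound by squares into one by the product of the norms.
  have hb : ∀ u v, |polar q u v| ≤ 2 * C * (‖u‖ * ‖v‖) := fun u v => by
    by_cases hu : u = 0
    · subst hu
      have := hreal 0 0 v
      simp_all
    by_cases hv : v = 0
    · subst hv
      have := hreal' 0 u 0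
      simp_all
    have hu' : 0 < ‖u‖ := norm_pos_iff.2 hu
    have hv' : 0 < ‖v‖ := norm_pos_iff.2 hv
    have hnorm : ∀ w : E, w ≠ 0 → ‖((‖w‖⁻¹ : ℝ) : ℂ) • w‖ = 1 := fun w hw => by
      rw [norm_smul, norm_real, norm_inv, norm_norm, inv_mul_cancel₀ (norm_ne_zero_iff.2 hw)]
    have h := hb1 (((‖u‖⁻¹ : ℝ) : ℂ) • u) (((‖v‖⁻¹ : ℝ) : ℂ) • v)
    rw [hnorm u hu, hnorm v hv, hreal, hreal', abs_mul, abs_mul, abs_of_pos (inv_pos.2 hu'),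
      abs_of_pos (inv_pos.2 hv'), ← mul_assoc, ← mul_inv, inv_mul_le_iff₀ (by positivity)] at h
    linarith
  -- The sesquilinear form `u, v ↦ ⟨Tu, v⟩`, recovered from its real part `polar q u v / 2`.
  let B : E →ₗ⋆[ℂ] E →ₗ[ℂ] ℂ := LinearMap.mk₂'ₛₗ (starRingEnd ℂ) (RingHom.id ℂ)
    (fun u v => (((polar q u v : ℝ) : ℂ) - I * ((polar q u (I • v) : ℝ) : ℂ)) / 2)
    (fun u v w => by simp only [hadd]; push_cast; ring)
    (fun c u v => by
      have h : ∀ w, polar q (c • u) w = c.re * polar q u w - c.im * polar q u (I • w) := fun w => by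
        conv_lhs => rw [← re_add_im c]
        rw [add_smul, hadd, hreal, mul_smul, hreal, hI']; ring
      rw [h, h, smul_smul, I_mul_I, neg_one_smul, hsymm u (-v), hneg, hsymm v,
        smul_eq_mul]
      apply Complex.ext <;> simp <;> ring)
    (fun u v w => by simp only [smul_add, hadd']; push_cast; ring)
    (fun c u v => by
      have h : ∀ w, polar q u (c • w) = c.re * polar q u w + c.im * polar q u (I • w) := fun w => by
        conv_lhs => rw [← re_add_im c]
        rw [add_smul, hadd', hreal', mul_smul, hreal']
      rw [smul_comm I c v, h, h, smul_smul, I_mul_I, neg_one_smul, hsymm u (-v), hneg, hsymm v,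
        smul_eq_mul]
      apply Complex.ext <;> simp <;> ring)
  have hB : ∀ u v, ‖B u v‖ ≤ 2 * C * ‖u‖ * ‖v‖ := fun u v => by
    have h1 := hb u v
    have h2 := hb u (I • v)
    rw [norm_smul, norm_I, one_mul] at h2
    change ‖(((polar q u v : ℝ) : ℂ) - I * ((polar q u (I • v) : ℝ) : ℂ)) / 2‖ ≤ _
    have h3 := norm_sub_le ((polar q u v : ℝ) : ℂ) (I * ((polar q u (I • v) : ℝ) : ℂ))
    rw [norm_mul, norm_I, one_mul, norm_real, norm_real, Real.norm_eq_abs, Real.norm_eq_abs] at h3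
    rw [norm_div, norm_ofNat]
    linarith
  let B' := B.mkContinuous₂ (2 * C) hB
  refine ⟨InnerProductSpace.continuousLinearMapOfBilin B', fun v => ?_⟩
  have h1 : inner ℂ (InnerProductSpace.continuousLinearMapOfBilin B' v) v = (q v : ℂ) := by
    rw [InnerProductSpace.continuousLinearMapOfBilin_apply]
    change (((polar q v v : ℝ) : ℂ) - I * ((polar q v (I • v) : ℝ) : ℂ)) / 2 = _
    have h2 : polar q v (I • v) = 0 := by
      have := hI' v v
      rw [hsymm] at this
      linarith
    rw [h2, hself]; push_cast; ring
  rw [← inner_conj_symm, h1, conj_ofReal]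

end Riesz

/-! ### Homogeneous extensions of functions on rays -/

section Quad

variable {ι : Type*} {H : ι → Type*} [∀ α, NormedAddCommGroup (H α)]
  [∀ α, InnerProductSpace ℂ (H α)]

/-- The bounded real functions on the set of pure states, with the sup-norm. -/
abbrev BddFun (H : ι → Type*) [∀ α, NormedAddCommGroup (H α)]
    [∀ α, InnerProductSpace ℂ (H α)] : Type _ :=
  lp (fun _ : PureStates H => ℝ) ⊤

open Classical in
/-- The extension of a function on the rays of `H α` to `H α`, homogeneous of degree two: its value
at `v` is `‖v‖² f(ℂv)`, and `0` at `v = 0`. -/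
def quad (f : PureStates H → ℝ) (α : ι) (v : H α) : ℝ :=
  if h : v = 0 then 0 else ‖v‖ ^ 2 * f ⟨α, Projectivization.mk ℂ v h⟩

theorem quad_of_ne (f : PureStates H → ℝ) {α : ι} {v : H α} (h : v ≠ 0) :
    quad f α v = ‖v‖ ^ 2 * f ⟨α, Projectivization.mk ℂ v h⟩ := dif_neg h

@[simp] theorem quad_zero_right (f : PureStates H → ℝ) (α : ι) : quad f α 0 = 0 := dif_pos rfl

theorem quad_smul_right (f : PureStates H → ℝ) (α : ι) (c : ℂ) (v : H α) :
    quad f α (c • v) = ‖c‖ ^ 2 * quad f α v := by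
  by_cases hv : v = 0
  · simp [hv]
  by_cases hc : c = 0
  · simp [hc]
  have h : Projectivization.mk ℂ (c • v) (smul_ne_zero hc hv) = Projectivization.mk ℂ v hv :=
    (Projectivization.mk_eq_mk_iff' ℂ _ _ _ _).2 ⟨c, rfl⟩
  rw [quad_of_ne f hv, quad_of_ne f (smul_ne_zero hc hv), norm_smul, h]
  ring

theorem quad_rep (f : PureStates H → ℝ) (σ : PureStates H) :
    quad f σ.1 σ.2.rep = ‖σ.2.rep‖ ^ 2 * f σ := by
  rw [quad_of_ne f σ.2.rep_nonzero, Projectivization.mk_rep]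

theorem apply_eq_quad_div (f : PureStates H → ℝ) (σ : PureStates H) :
    f σ = quad f σ.1 σ.2.rep / ‖σ.2.rep‖ ^ 2 := by
  have := norm_ne_zero_iff.2 σ.2.rep_nonzero
  rw [quad_rep]; field_simp

theorem quad_add (f g : PureStates H → ℝ) (α : ι) (v : H α) :
    quad (f + g) α v = quad f α v + quad g α v := by
  unfold quad; split_ifs <;> simp [mul_add]

theorem quad_sub (f g : PureStates H → ℝ) (α : ι) (v : H α) :
    quad (f - g) α v = quad f α v - quad g α v := by
  unfold quad; split_ifs <;> simp [mul_sub]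

theorem quad_smul (t : ℝ) (f : PureStates H → ℝ) (α : ι) (v : H α) :
    quad (t • f) α v = t * quad f α v := by
  unfold quad; split_ifs <;> simp; ring

@[simp] theorem quad_zero (α : ι) (v : H α) : quad (0 : PureStates H → ℝ) α v = 0 := by
  unfold quad; split_ifs <;> simp

theorem funext_quad {f g : PureStates H → ℝ} (h : ∀ α v, quad f α v = quad g α v) : f = g := by
  ext σ
  rw [apply_eq_quad_div f, apply_eq_quad_div g, h]

theorem BddFun.ext_quad {f g : BddFun H} (h : ∀ α v, quad f α v = quad g α v) : f = g :=
  lp.ext (funext_quad h)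

theorem abs_quad_le (f : BddFun H) (α : ι) (v : H α) : |quad f α v| ≤ ‖f‖ * ‖v‖ ^ 2 := by
  by_cases h : v = 0
  · simp [h]
  · rw [quad_of_ne _ h, abs_mul, abs_of_nonneg (sq_nonneg _), mul_comm]
    gcongr
    exact lp.norm_apply_le_norm ENNReal.top_ne_zero f _

theorem BddFun.norm_le_of_quad {f : BddFun H} {C : ℝ} (hC : 0 ≤ C)
    (h : ∀ α v, |quad f α v| ≤ C * ‖v‖ ^ 2) : ‖f‖ ≤ C := by
  refine lp.norm_le_of_forall_le hC fun σ => ?_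
  have hσ : 0 < ‖σ.2.rep‖ := norm_pos_iff.2 σ.2.rep_nonzero
  rw [Real.norm_eq_abs, apply_eq_quad_div f, abs_div, abs_of_pos (pow_pos hσ 2),
    div_le_iff₀ (by positivity)]
  exact h _ _

/-- The function on pure states whose homogeneous extension is a given bounded function, homogeneous
of degree two. -/
def ofQuad (q : ∀ α, H α → ℝ) (C : ℝ) (hC : ∀ α v, |q α v| ≤ C * ‖v‖ ^ 2) : BddFun H :=
  ⟨fun σ => q σ.1 σ.2.rep / ‖σ.2.rep‖ ^ 2, memℓp_infty ⟨C, by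
    rintro _ ⟨σ, rfl⟩
    have hσ : 0 < ‖σ.2.rep‖ := norm_pos_iff.2 σ.2.rep_nonzero
    simp only
    rw [Real.norm_eq_abs, abs_div, abs_of_pos (pow_pos hσ 2), div_le_iff₀ (by positivity)]
    exact hC _ _⟩⟩

theorem quad_ofQuad (q : ∀ α, H α → ℝ) (C : ℝ) (hC : ∀ α v, |q α v| ≤ C * ‖v‖ ^ 2)
    (hq : ∀ α (c : ℂ) v, q α (c • v) = ‖c‖ ^ 2 * q α v) (α : ι) (v : H α) :
    quad (ofQuad q C hC) α v = q α v := by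
  by_cases h : v = 0
  · subst h
    have := hq α 0 0
    simp_all
  · rw [quad_of_ne _ h]
    change ‖v‖ ^ 2 * (q α (Projectivization.mk ℂ v h).rep / ‖(Projectivization.mk ℂ v h).rep‖ ^ 2)
      = _
    obtain ⟨a, ha⟩ := Projectivization.exists_smul_eq_mk_rep ℂ v h
    have hv : ‖v‖ ≠ 0 := norm_ne_zero_iff.2 h
    have ha0 : ‖(a : ℂ)‖ ≠ 0 := norm_ne_zero_iff.2 a.ne_zero
    rw [← ha, Units.smul_def, hq, norm_smul]
    field_simp

open Classical in
theorem quad_probVec (ρ : PureStates H) (α : ι) (v : H α) :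
    quad ((pureProb H).probVec ρ) α v =
      if h : ρ.1 = α then ‖inner ℂ (h ▸ ρ.2.rep) v‖ ^ 2 / ‖ρ.2.rep‖ ^ 2 else 0 := by
  obtain ⟨β, x⟩ := ρ
  by_cases hv : v = 0
  · subst hv; split_ifs with h
    · subst h; simp
    · simp
  rw [quad_of_ne _ hv, TransitionProbability.probVec_apply]
  split_ifs with h
  · obtain rfl : β = α := h
    have hv' : ‖v‖ ≠ 0 := norm_ne_zero_iff.2 hv
    have hx : ‖x.rep‖ ≠ 0 := norm_ne_zero_iff.2 x.rep_nonzero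
    rw [pureProb_same]
    conv_lhs => rw [← x.mk_rep]
    rw [rayProb_mk]
    field_simp
  · rw [pureProb_of_ne H h, mul_zero]

theorem quad_probVec_mk (α : ι) (u v : H α) (hu : u ≠ 0) :
    quad ((pureProb H).probVec ⟨α, Projectivization.mk ℂ u hu⟩) α v =
      ‖inner ℂ u v‖ ^ 2 / ‖u‖ ^ 2 := by
  by_cases hv : v = 0
  · subst hv; simp
  have hv' : ‖v‖ ≠ 0 := norm_ne_zero_iff.2 hv
  have hu' : ‖u‖ ≠ 0 := norm_ne_zero_iff.2 hu
  rw [quad_of_ne _ hv, TransitionProbability.probVec_apply, pureProb_same, rayProb_mk]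
  field_simp

theorem quad_probVec_of_ne {ρ : PureStates H} {α : ι} (h : ρ.1 ≠ α) (v : H α) :
    quad ((pureProb H).probVec ρ) α v = 0 := by
  rw [quad_probVec, dif_neg h]

end Quad

/-! ### Functions of families of self-adjoint operators -/

section Op

variable {ι : Type*} {H : ι → Type*} [∀ α, NormedAddCommGroup (H α)]
  [∀ α, InnerProductSpace ℂ (H α)]

/-- `T` is the operator on `H α` with quadratic form `f`, that is, `f(ℂΩ) = ⟨Ω, TΩ⟩` for unit
vectors `Ω`. As `f` is real, such a `T` is self-adjoint. -/
def IsOp (f : PureStates H → ℝ) (α : ι) (T : H α →L[ℂ] H α) : Prop :=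
  ∀ v, inner ℂ v (T v) = (quad f α v : ℂ)

theorem IsOp.isSymmetric {f : PureStates H → ℝ} {α : ι} {T : H α →L[ℂ] H α} (h : IsOp f α T) :
    (T : H α →ₗ[ℂ] H α).IsSymmetric := by
  rw [LinearMap.isSymmetric_iff_inner_map_self_real]
  intro v
  rw [← inner_conj_symm, ContinuousLinearMap.coe_coe, h v, conj_conj]
  simp

theorem IsOp.inner_left {f : PureStates H → ℝ} {α : ι} {T : H α →L[ℂ] H α} (h : IsOp f α T)
    (u v : H α) : inner ℂ (T u) v = inner ℂ u (T v) := h.isSymmetric u v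

theorem IsOp.unique {f : PureStates H → ℝ} {α : ι} {S T : H α →L[ℂ] H α} (hS : IsOp f α S)
    (hT : IsOp f α T) : S = T := by
  have h : (S : H α →ₗ[ℂ] H α) = T := by
    rw [← ext_inner_map]
    intro v
    change inner ℂ (S v) v = inner ℂ (T v) v
    rw [hS.inner_left, hT.inner_left, hS v, hT v]
  exact ContinuousLinearMap.coe_injective h

theorem IsOp.re_inner {f : PureStates H → ℝ} {α : ι} {T : H α →L[ℂ] H α} (h : IsOp f α T)
    (v : H α) : (inner ℂ v (T v)).re = quad f α v := by
  rw [h v, ofReal_re]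

theorem IsOp.polar {f : PureStates H → ℝ} {α : ι} {T : H α →L[ℂ] H α} (h : IsOp f α T)
    (u v : H α) : polar (quad f α) u v = 2 * (inner ℂ u (T v)).re := by
  have h1 : (inner ℂ v (T u)).re = (inner ℂ u (T v)).re := by
    rw [← h.inner_left, ← inner_conj_symm, conj_re]
  rw [QuadraticMap.polar, ← h.re_inner, ← h.re_inner, ← h.re_inner, map_add, inner_add_left,
    inner_add_right, inner_add_right]
  simp only [add_re, h1]; ring

theorem IsOp.add {f g : PureStates H → ℝ} {α : ι} {S T : H α →L[ℂ] H α} (hS : IsOp f α S)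
    (hT : IsOp g α T) : IsOp (f + g) α (S + T) := fun v => by
  rw [add_apply, inner_add_right, hS v, hT v, quad_add]; push_cast; rfl

theorem IsOp.smul {f : PureStates H → ℝ} {α : ι} {T : H α →L[ℂ] H α} (t : ℝ) (hT : IsOp f α T) :
    IsOp (t • f) α ((t : ℂ) • T) := fun v => by
  rw [smul_apply, inner_smul_right, hT v, quad_smul]; push_cast; rfl

theorem isOp_zero (α : ι) : IsOp (0 : PureStates H → ℝ) α 0 := fun v => by simp

theorem norm_le_of_isOp {f : BddFun H} {α : ι} {T : H α →L[ℂ] H α} (h : IsOp f α T) :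
    ‖T‖ ≤ ‖f‖ := by
  refine T.opNorm_le_bound (norm_nonneg _) fun v => ?_
  by_cases hT : T v = 0
  · rw [hT, norm_zero]; positivity
  by_cases hv : v = 0
  · simp [hv]
  have hT' : 0 < ‖T v‖ := norm_pos_iff.2 hT
  have hv' : 0 < ‖v‖ := norm_pos_iff.2 hv
  -- Rescale `T v` to the length of `v`, and apply polarization and the parallelogram law.
  set u : H α := ((‖v‖ / ‖T v‖ : ℝ) : ℂ) • T v with hu
  have hun : ‖u‖ = ‖v‖ := by
    rw [hu, norm_smul, norm_real, norm_div, norm_norm, norm_norm]; field_simp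
  have h1 : (inner ℂ u (T v)).re = ‖v‖ * ‖T v‖ := by
    rw [hu, inner_smul_left, conj_ofReal, re_ofReal_mul, inner_self_eq_norm_sq_to_K]
    norm_cast
    simp only [coe_algebraMap, ofReal_re]
    field_simp
  have h2 : 4 * (inner ℂ u (T v)).re = quad f α (u + v) - quad f α (u - v) := by
    have h3 := h.polar u v
    have h4 := h.polar u (-v)
    have h5 : quad f α (-v) = quad f α v := by
      have := quad_smul_right f α (-1) v; simpa using this
    rw [map_neg, inner_neg_right, neg_re] at h4
    simp only [QuadraticMap.polar, h5, ← sub_eq_add_neg] at h3 h4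
    linarith
  have h6 := abs_quad_le f α (u + v)
  have h7 := abs_quad_le f α (u - v)
  have h8 := parallelogram_law_with_norm ℂ u v
  have h9 : ‖f‖ * ‖u + v‖ ^ 2 + ‖f‖ * ‖u - v‖ ^ 2 = 4 * (‖f‖ * ‖v‖ ^ 2) := by
    rw [← mul_add, h8, hun]; ring
  rw [abs_le] at h6 h7
  have h10 : ‖v‖ * ‖T v‖ ≤ ‖v‖ * (‖f‖ * ‖v‖) := by
    rw [h1] at h2; nlinarith
  exact le_of_mul_le_mul_left h10 hv'

open Classical in
/-- The operator on `H α` with quadratic form `f` (and `0` if there is none). -/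
def op (f : PureStates H → ℝ) (α : ι) : H α →L[ℂ] H α :=
  if h : ∃ T, IsOp f α T then h.choose else 0

theorem IsOp.op_eq {f : PureStates H → ℝ} {α : ι} {T : H α →L[ℂ] H α} (h : IsOp f α T) :
    op f α = T := by
  have h' : ∃ T, IsOp f α T := ⟨T, h⟩
  rw [op, dif_pos h']
  exact h'.choose_spec.unique h

theorem norm_op_le (f : BddFun H) (α : ι) : ‖op f α‖ ≤ ‖f‖ := by
  by_cases h : ∃ T, IsOp f α T
  · obtain ⟨T, hT⟩ := h
    rw [hT.op_eq]; exact norm_le_of_isOp hT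
  · rw [op, dif_neg h, norm_zero]; exact norm_nonneg _

variable (H) in
/-- The bounded functions on the pure states given by families of self-adjoint operators. -/
def opSpace : Submodule ℝ (BddFun H) where
  carrier := {f | ∀ α, ∃ T, IsOp f α T}
  add_mem' hf hg α := by
    obtain ⟨S, hS⟩ := hf α
    obtain ⟨T, hT⟩ := hg α
    exact ⟨_, hS.add hT⟩
  zero_mem' α := ⟨_, isOp_zero α⟩
  smul_mem' t f hf α := by
    obtain ⟨S, hS⟩ := hf α
    exact ⟨_, hS.smul t⟩

theorem isOp_op {f : BddFun H} (hf : f ∈ opSpace H) (α : ι) : IsOp f α (op f α) := by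
  obtain ⟨T, hT⟩ := hf α
  rwa [hT.op_eq]

theorem op_add {f g : BddFun H} (hf : f ∈ opSpace H) (hg : g ∈ opSpace H) (α : ι) :
    op (f + g : BddFun H) α = op f α + op g α :=
  ((isOp_op hf α).add (isOp_op hg α)).op_eq

theorem op_smul (t : ℝ) {f : BddFun H} (hf : f ∈ opSpace H) (α : ι) :
    op (t • f : BddFun H) α = (t : ℂ) • op f α :=
  ((isOp_op hf α).smul t).op_eq

theorem eq_of_op_eq {f g : BddFun H} (hf : f ∈ opSpace H) (hg : g ∈ opSpace H)
    (h : ∀ α, op f α = op g α) : f = g :=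
  BddFun.ext_quad fun α v => by
    rw [← (isOp_op hf α).re_inner, ← (isOp_op hg α).re_inner, h]

/-- Membership in `opSpace` is a system of linear equations between values of the function, hence a
condition closed under pointwise limits. -/
theorem mem_opSpace_iff [∀ α, CompleteSpace (H α)] {f : BddFun H} :
    f ∈ opSpace H ↔ ∀ α, (∀ u v w, polar (quad f α) (u + v) w =
      polar (quad f α) u w + polar (quad f α) v w) ∧
      ∀ (t : ℝ) u v, polar (quad f α) ((t : ℂ) • u) v = t * polar (quad f α) u v := by
  refine forall_congr' fun α => ⟨?_, fun ⟨h1, h2⟩ => ?_⟩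
  · rintro ⟨T, hT⟩
    refine ⟨fun u v w => ?_, fun t u v => ?_⟩
    · rw [hT.polar, hT.polar, hT.polar, inner_add_left, add_re]; ring
    · rw [hT.polar, hT.polar, inner_smul_left, conj_ofReal, re_ofReal_mul]; ring
  · exact exists_clm_of_polar _ ‖f‖ (abs_quad_le f α) (quad_smul_right f α) h1 h2

end Op

/-! ### The Jordan product of operators -/

section Jordan

variable {ι : Type*} {H : ι → Type*} [∀ α, NormedAddCommGroup (H α)]
  [∀ α, InnerProductSpace ℂ (H α)]

/-- `f ↦ quad f α v` as a continuous linear functional: `‖v‖²` times evaluation at the ray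
of `v`. -/
def quadCLM (α : ι) (v : H α) : BddFun H →L[ℝ] ℝ :=
  LinearMap.mkContinuous
    { toFun := fun f => quad f α v
      map_add' := fun f g => quad_add f g α v
      map_smul' := fun t f => quad_smul t f α v } (‖v‖ ^ 2)
    fun f => by rw [mul_comm]; exact abs_quad_le f α v

@[simp] theorem quadCLM_apply (α : ι) (v : H α) (f : BddFun H) : quadCLM α v f = quad f α v := rfl

theorem isClosed_opSpace [∀ α, CompleteSpace (H α)] : IsClosed (opSpace H : Set (BddFun H)) := by
  have h : (opSpace H : Set (BddFun H)) = ⋂ α, ((⋂ u, ⋂ v, ⋂ w,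
      {f | polar (fun x => quadCLM α x f) (u + v) w =
        polar (fun x => quadCLM α x f) u w + polar (fun x => quadCLM α x f) v w}) ∩
      ⋂ t : ℝ, ⋂ u, ⋂ v, {f | polar (fun x => quadCLM α x f) ((t : ℂ) • u) v =
        t * polar (fun x => quadCLM α x f) u v}) := by
    ext f
    rw [SetLike.mem_coe, mem_opSpace_iff]
    simp only [Set.mem_iInter, Set.mem_inter_iff, Set.mem_ofPred_eq, quadCLM_apply]
  rw [h]
  refine isClosed_iInter fun α => IsClosed.inter ?_ ?_
  · refine isClosed_iInter fun u => isClosed_iInter fun v => isClosed_iInter fun w =>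
      isClosed_eq ?_ ?_
    · unfold polar; fun_prop
    · unfold polar; fun_prop
  · refine isClosed_iInter fun u => isClosed_iInter fun v => isClosed_iInter fun w =>
      isClosed_eq ?_ ?_
    · unfold polar; fun_prop
    · unfold polar; fun_prop

theorem abs_re_inner_op_le (f g : BddFun H) (α : ι) (v : H α) :
    |(inner ℂ (op f α v) (op g α v)).re| ≤ ‖f‖ * ‖g‖ * ‖v‖ ^ 2 :=
  calc _ ≤ ‖inner ℂ (op f α v) (op g α v)‖ := abs_re_le_norm _
    _ ≤ ‖op f α v‖ * ‖op g α v‖ := norm_inner_le_norm _ _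
    _ ≤ (‖f‖ * ‖v‖) * (‖g‖ * ‖v‖) := by
      gcongr
      · exact (op f α).le_of_opNorm_le (norm_op_le f α) v
      · exact (op g α).le_of_opNorm_le (norm_op_le g α) v
    _ = _ := by ring

/-- The function given by the Jordan product `(ST + TS)/2` of the operators `S`, `T` of `f`, `g`,
whose value at a unit vector `Ω` is `Re ⟨SΩ, TΩ⟩`. -/
def jmul (f g : BddFun H) : BddFun H :=
  ofQuad (fun α v => (inner ℂ (op f α v) (op g α v)).re) (‖f‖ * ‖g‖) (abs_re_inner_op_le f g)

theorem quad_jmul (f g : BddFun H) (α : ι) (v : H α) :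
    quad (jmul f g) α v = (inner ℂ (op f α v) (op g α v)).re := by
  refine quad_ofQuad _ _ _ (fun α c v => ?_) α v
  rw [map_smul, map_smul, inner_smul_left, inner_smul_right, ← mul_assoc, conj_mul']
  rw [← ofReal_pow, re_ofReal_mul]

theorem norm_jmul_le (f g : BddFun H) : ‖jmul f g‖ ≤ ‖f‖ * ‖g‖ :=
  BddFun.norm_le_of_quad (by positivity) fun α v => by
    rw [quad_jmul]; exact abs_re_inner_op_le f g α v

theorem isOp_jmul {f g : BddFun H} (hf : f ∈ opSpace H) (hg : g ∈ opSpace H) (α : ι) :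
    IsOp (jmul f g) α ((1 / 2 : ℂ) • (op f α * op g α + op g α * op f α)) := fun v => by
  rw [quad_jmul, smul_apply, add_apply, mul_apply_eq_comp,
    mul_apply_eq_comp, inner_smul_right, inner_add_right,
    ← (isOp_op hf α).inner_left v (op g α v), ← (isOp_op hg α).inner_left v (op f α v),
    ← inner_conj_symm (op g α v), add_conj]
  push_cast; ring

theorem jmul_mem_opSpace {f g : BddFun H} (hf : f ∈ opSpace H) (hg : g ∈ opSpace H) :
    jmul f g ∈ opSpace H := fun α => ⟨_, isOp_jmul hf hg α⟩

theorem op_jmul {f g : BddFun H} (hf : f ∈ opSpace H) (hg : g ∈ opSpace H) (α : ι) :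
    op (jmul f g) α = (1 / 2 : ℂ) • (op f α * op g α + op g α * op f α) :=
  (isOp_jmul hf hg α).op_eq

theorem op_jmul_self {f : BddFun H} (hf : f ∈ opSpace H) (α : ι) :
    op (jmul f f) α = op f α * op f α := by
  rw [op_jmul hf hf, ← two_smul ℂ (op f α * op f α), smul_smul]; norm_num

theorem quad_jmul_self (f : BddFun H) (α : ι) (v : H α) :
    quad (jmul f f) α v = ‖op f α v‖ ^ 2 := by
  rw [quad_jmul, inner_self_eq_norm_sq_to_K]
  norm_cast

theorem jmul_comm (f g : BddFun H) : jmul f g = jmul g f :=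
  BddFun.ext_quad fun α v => by
    rw [quad_jmul, quad_jmul, ← inner_conj_symm, conj_re]

theorem jmul_add_left {f g h : BddFun H} (hf : f ∈ opSpace H) (hg : g ∈ opSpace H) :
    jmul (f + g) h = jmul f h + jmul g h :=
  BddFun.ext_quad fun α v => by
    rw [quad_jmul, op_add hf hg, lp.coeFn_add, quad_add, quad_jmul, quad_jmul, add_apply,
      inner_add_left, add_re]

theorem jmul_smul_left (t : ℝ) {f g : BddFun H} (hf : f ∈ opSpace H) :
    jmul (t • f) g = t • jmul f g :=
  BddFun.ext_quad fun α v => by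
    rw [quad_jmul, op_smul t hf, lp.coeFn_smul, quad_smul, quad_jmul, smul_apply,
      inner_smul_left, conj_ofReal, re_ofReal_mul]

theorem jmul_jordan {f g : BddFun H} (hf : f ∈ opSpace H) (hg : g ∈ opSpace H) :
    jmul (jmul f f) (jmul f g) = jmul f (jmul (jmul f f) g) := by
  have hff := jmul_mem_opSpace hf hf
  refine eq_of_op_eq (jmul_mem_opSpace hff (jmul_mem_opSpace hf hg))
    (jmul_mem_opSpace hf (jmul_mem_opSpace hff hg)) fun α => ?_
  rw [op_jmul hff (jmul_mem_opSpace hf hg), op_jmul hf (jmul_mem_opSpace hff hg),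
    op_jmul hf hg, op_jmul hff hg, op_jmul_self hf]
  simp only [mul_smul_comm, smul_mul_assoc, mul_add, add_mul, smul_add, mul_assoc]
  abel

theorem norm_jmul_self {f : BddFun H} (hf : f ∈ opSpace H) : ‖jmul f f‖ = ‖f‖ ^ 2 := by
  refine le_antisymm ((norm_jmul_le f f).trans_eq (pow_two _).symm) ?_
  have h : ‖f‖ ≤ √‖jmul f f‖ := BddFun.norm_le_of_quad (Real.sqrt_nonneg _) fun α v => by
    have h1 := abs_quad_le (jmul f f) α v
    rw [quad_jmul_self, abs_of_nonneg (sq_nonneg _)] at h1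
    have h2 : ‖op f α v‖ ≤ √‖jmul f f‖ * ‖v‖ := by
      refine abs_le_of_sq_le_sq' ?_ (by positivity) |>.2
      rwa [mul_pow, Real.sq_sqrt (norm_nonneg _)]
    rw [← (isOp_op hf α).re_inner]
    calc _ ≤ ‖inner ℂ v (op f α v)‖ := abs_re_le_norm _
      _ ≤ ‖v‖ * ‖op f α v‖ := norm_inner_le_norm _ _
      _ ≤ ‖v‖ * (√‖jmul f f‖ * ‖v‖) := by gcongr
      _ = _ := by ring
  calc ‖f‖ ^ 2 ≤ √‖jmul f f‖ ^ 2 := by gcongr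
    _ = _ := Real.sq_sqrt (norm_nonneg _)

theorem norm_jmul_self_le (f g : BddFun H) : ‖jmul f f‖ ≤ ‖jmul f f + jmul g g‖ := by
  refine BddFun.norm_le_of_quad (norm_nonneg _) fun α v => ?_
  refine le_trans ?_ (abs_quad_le (jmul f f + jmul g g) α v)
  rw [lp.coeFn_add, quad_add, quad_jmul_self, quad_jmul_self, abs_of_nonneg (by positivity),
    abs_of_nonneg (by positivity)]
  exact le_add_of_nonneg_right (sq_nonneg _)

/-- The Jordan product on a subspace of `opSpace` closed under it. -/
def subMul {W : Submodule ℝ (BddFun H)} (hW : ∀ f ∈ W, ∀ g ∈ W, jmul f g ∈ W) (f g : W) : W :=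
  ⟨jmul f g, hW f f.2 g g.2⟩

theorem isJordanProduct_subMul {W : Submodule ℝ (BddFun H)} (hV : W ≤ opSpace H)
    (hW : ∀ f ∈ W, ∀ g ∈ W, jmul f g ∈ W) : IsJordanProduct (subMul hW) where
  add_left a b _ := Subtype.ext (jmul_add_left (hV a.2) (hV b.2))
  smul_left t a _ := Subtype.ext (jmul_smul_left t (hV a.2))
  comm a b := Subtype.ext (jmul_comm a.1 b.1)
  jordan a b := Subtype.ext (jmul_jordan (hV a.2) (hV b.2))

theorem isJBProduct_subMul {W : Submodule ℝ (BddFun H)} (hV : W ≤ opSpace H)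
    (hW : ∀ f ∈ W, ∀ g ∈ W, jmul f g ∈ W) (hc : IsClosed (W : Set (BddFun H))) :
    IsJBProduct (subMul hW) where
  toIsJordanProduct := isJordanProduct_subMul hV hW
  complete := hc.completeSpace_coe
  norm_mul_le a b := norm_jmul_le a.1 b.1
  norm_sq a := norm_jmul_self (hV a.2)
  norm_sq_le a b := norm_jmul_self_le a.1 b.1

/-- Bilinearity and `‖f ∘ g‖ ≤ ‖f‖ ‖g‖` make the Jordan product jointly continuous. -/
theorem continuousOn_jmul :
    ContinuousOn (fun x : BddFun H × BddFun H => jmul x.1 x.2)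
      ((opSpace H : Set (BddFun H)) ×ˢ (opSpace H : Set (BddFun H))) := by
  let m : opSpace H →ₗ[ℝ] opSpace H →ₗ[ℝ] BddFun H := LinearMap.mk₂ ℝ (fun f g => jmul f.1 g.1)
    (fun f g h => jmul_add_left f.2 g.2) (fun t f g => jmul_smul_left t f.2)
    (fun f g h => by
      rw [jmul_comm f.1, jmul_comm f.1, jmul_comm f.1]; exact jmul_add_left g.2 h.2)
    (fun t f g => by rw [jmul_comm f.1, jmul_comm f.1]; exact jmul_smul_left t g.2)
  let M := m.mkContinuous₂ 1 fun f g => by rw [one_mul]; exact norm_jmul_le f.1 g.1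
  have hM : Continuous fun x : opSpace H × opSpace H => M x.1 x.2 := by fun_prop
  rw [continuousOn_iff_continuous_domRestrict]
  let e : ((opSpace H : Set (BddFun H)) ×ˢ (opSpace H : Set (BddFun H)) : Set _) →
      opSpace H × opSpace H := fun x => (⟨x.1.1, x.2.1⟩, ⟨x.1.2, x.2.2⟩)
  have he : Continuous e := by fun_prop
  exact hM.comp he

end Jordan

/-! ### Finite rank operators -/

section FiniteRank

variable {ι : Type*} {H : ι → Type*} [∀ α, NormedAddCommGroup (H α)]
  [∀ α, InnerProductSpace ℂ (H α)]

open Classical in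
/-- The function of the operator `|u⟩⟨u|` on `H α`, whose homogeneous extension is
`v ↦ |⟨u, v⟩|²`. -/
def vecFun (α : ι) (u : H α) : BddFun H :=
  if h : u = 0 then 0 else ‖u‖ ^ 2 • (pureProb H).probVec ⟨α, Projectivization.mk ℂ u h⟩

theorem vecFun_mem (α : ι) (u : H α) : vecFun α u ∈ (pureProb H).A00 := by
  unfold vecFun
  split_ifs
  · exact zero_mem _
  · exact Submodule.smul_mem _ _ (Submodule.subset_span ⟨_, rfl⟩)

theorem quad_vecFun (α : ι) (u v : H α) : quad (vecFun α u) α v = ‖inner ℂ u v‖ ^ 2 := by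
  unfold vecFun
  split_ifs with h
  · rw [h, inner_zero_left, norm_zero, zero_pow two_ne_zero]; exact quad_zero α v
  · have hu : ‖u‖ ≠ 0 := norm_ne_zero_iff.2 h
    rw [lp.coeFn_smul, quad_smul, quad_probVec_mk]
    field_simp

theorem quad_vecFun_of_ne {α β : ι} (h : α ≠ β) (u : H α) (v : H β) :
    quad (vecFun α u) β v = 0 := by
  unfold vecFun
  split_ifs
  · exact quad_zero β v
  · rw [lp.coeFn_smul, quad_smul, quad_probVec_of_ne (by exact h), mul_zero]

theorem probVec_eq_smul_vecFun (ρ : PureStates H) :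
    (pureProb H).probVec ρ = (‖ρ.2.rep‖ ^ 2)⁻¹ • vecFun ρ.1 ρ.2.rep := by
  have h := ρ.2.rep_nonzero
  rw [vecFun, dif_neg h, smul_smul, inv_mul_cancel₀ (pow_ne_zero 2 (norm_ne_zero_iff.2 h)),
    one_smul, Projectivization.mk_rep]

theorem isOp_vecFun (α : ι) (u : H α) :
    IsOp (vecFun α u) α (InnerProductSpace.rankOne ℂ u u) := fun v => by
  rw [quad_vecFun, InnerProductSpace.rankOne_apply, inner_smul_right, ← inner_conj_symm v u,
    mul_conj']
  push_cast; rfl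

theorem isOp_vecFun_of_ne {α β : ι} (h : α ≠ β) (u : H α) : IsOp (vecFun α u) β 0 := fun v => by
  rw [quad_vecFun_of_ne h]; simp

theorem vecFun_mem_opSpace (α : ι) (u : H α) : vecFun α u ∈ opSpace H := fun β => by
  by_cases h : α = β
  · subst h; exact ⟨_, isOp_vecFun α u⟩
  · exact ⟨_, isOp_vecFun_of_ne h u⟩

/-- Induction over `𝔄₀₀` in terms of the generators `vecFun α u`. -/
theorem A00_induction {C : BddFun H → Prop} (hvec : ∀ α u, C (vecFun α u)) (h0 : C 0)
    (hadd : ∀ f g, f ∈ (pureProb H).A00 → g ∈ (pureProb H).A00 → C f → C g → C (f + g))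
    (hsmul : ∀ (t : ℝ) f, f ∈ (pureProb H).A00 → C f → C (t • f))
    {f : BddFun H} (hf : f ∈ (pureProb H).A00) : C f := by
  induction hf using Submodule.span_induction with
  | mem f h =>
    obtain ⟨ρ, rfl⟩ := h
    rw [probVec_eq_smul_vecFun]
    exact hsmul _ _ (vecFun_mem _ _) (hvec _ _)
  | zero => exact h0
  | add f g hf hg h1 h2 => exact hadd f g hf hg h1 h2
  | smul t f hf h => exact hsmul t f hf h

theorem A00_le_opSpace : (pureProb H).A00 ≤ opSpace H := fun _ hf =>
  A00_induction (C := fun f => f ∈ opSpace H) vecFun_mem_opSpace (zero_mem _)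
    (fun _ _ _ _ => add_mem) (fun t _ _ => Submodule.smul_mem _ t) hf

theorem A0_le_opSpace [∀ α, CompleteSpace (H α)] : (pureProb H).A0 ≤ opSpace H :=
  Submodule.topologicalClosure_minimal _ A00_le_opSpace isClosed_opSpace

/-- The function of the self-adjoint operator `(|u⟩⟨w| + |w⟩⟨u|)/2`. -/
def rankTwoFun (α : ι) (u w : H α) : BddFun H :=
  (1 / 2 : ℝ) • (vecFun α (u + w) - vecFun α u - vecFun α w)

theorem rankTwoFun_mem (α : ι) (u w : H α) : rankTwoFun α u w ∈ (pureProb H).A00 :=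
  Submodule.smul_mem _ _ (sub_mem (sub_mem (vecFun_mem _ _) (vecFun_mem _ _)) (vecFun_mem _ _))

theorem quad_rankTwoFun (α : ι) (u w v : H α) :
    quad (rankTwoFun α u w) α v = (inner ℂ v u * inner ℂ w v).re := by
  rw [rankTwoFun, lp.coeFn_smul, quad_smul, lp.coeFn_sub, quad_sub, lp.coeFn_sub, quad_sub,
    quad_vecFun, quad_vecFun, quad_vecFun, inner_add_left, ← inner_conj_symm v u,
    ← normSq_eq_norm_sq, ← normSq_eq_norm_sq, ← normSq_eq_norm_sq, normSq_add, mul_re, mul_re,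
    conj_re, conj_im, conj_re, conj_im]
  ring

theorem quad_rankTwoFun_of_ne {α β : ι} (h : α ≠ β) (u w : H α) (v : H β) :
    quad (rankTwoFun α u w) β v = 0 := by
  rw [rankTwoFun, lp.coeFn_smul, quad_smul, lp.coeFn_sub, quad_sub, lp.coeFn_sub, quad_sub,
    quad_vecFun_of_ne h, quad_vecFun_of_ne h, quad_vecFun_of_ne h]
  simp

theorem jmul_vecFun (α : ι) (u : H α) {g : BddFun H} (hg : g ∈ opSpace H) :
    jmul (vecFun α u) g = rankTwoFun α u (op g α u) :=
  BddFun.ext_quad fun β v => by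
    rw [quad_jmul]
    by_cases h : α = β
    · subst h
      rw [(isOp_vecFun α u).op_eq, quad_rankTwoFun, InnerProductSpace.rankOne_apply,
        inner_smul_left, inner_conj_symm, (isOp_op hg α).inner_left]
    · rw [(isOp_vecFun_of_ne h u).op_eq, quad_rankTwoFun_of_ne h]
      simp

/-- `𝔄₀₀` is a Jordan ideal of `opSpace`, as the finite rank operators are an ideal. -/
theorem jmul_mem_A00 {f g : BddFun H} (hf : f ∈ (pureProb H).A00) (hg : g ∈ opSpace H) :
    jmul f g ∈ (pureProb H).A00 := by
  refine A00_induction (C := fun f => jmul f g ∈ (pureProb H).A00) (fun α u => ?_) ?_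
    (fun f h hf hh h1 h2 => ?_) (fun t f hf h1 => ?_) hf
  · rw [jmul_vecFun α u hg]; exact rankTwoFun_mem _ _ _
  · have := jmul_smul_left 0 (g := g) (zero_mem (opSpace H))
    rw [zero_smul, zero_smul] at this
    rw [this]; exact zero_mem _
  · rw [jmul_add_left (A00_le_opSpace hf) (A00_le_opSpace hh)]; exact add_mem h1 h2
  · rw [jmul_smul_left t (A00_le_opSpace hf)]; exact Submodule.smul_mem _ _ h1

theorem jmul_mem_A0 [∀ α, CompleteSpace (H α)] {f g : BddFun H} (hf : f ∈ (pureProb H).A0)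
    (hg : g ∈ (pureProb H).A0) : jmul f g ∈ (pureProb H).A0 := by
  have h : Set.MapsTo (fun x : BddFun H × BddFun H => jmul x.1 x.2)
      (((pureProb H).A00 : Set (BddFun H)) ×ˢ ((pureProb H).A00 : Set (BddFun H)))
      ((pureProb H).A00 : Set (BddFun H)) := fun x hx => jmul_mem_A00 hx.1 (A00_le_opSpace hx.2)
  have hc := h.closure_of_continuousOn (continuousOn_jmul.mono (by
    rw [closure_prod_eq]; exact Set.prod_mono A0_le_opSpace A0_le_opSpace))
  rw [closure_prod_eq] at hc
  exact hc (x := (f, g)) ⟨hf, hg⟩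

theorem isCompactOperator_op {f : BddFun H} (hf : f ∈ (pureProb H).A00) (α : ι) :
    IsCompactOperator (op f α) := by
  refine A00_induction (C := fun f => IsCompactOperator (op f α)) (fun β u => ?_) ?_
    (fun f g hf hg h1 h2 => ?_) (fun t f hf h1 => ?_) hf
  · by_cases h : β = α
    · subst h
      rw [(isOp_vecFun β u).op_eq, InnerProductSpace.rankOne_def']
      have hc : IsCompactOperator (innerSL ℂ u) := isCompactOperator_of_locallyCompactSpace_dom _
      exact hc.clm_comp (ContinuousLinearMap.toSpanSingleton ℂ u)
    · rw [(isOp_vecFun_of_ne h u).op_eq]; exact isCompactOperator_zero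
  · rw [lp.coeFn_zero, (isOp_zero α).op_eq]; exact isCompactOperator_zero
  · rw [op_add (A00_le_opSpace hf) (A00_le_opSpace hg)]; exact h1.add h2
  · rw [op_smul t (A00_le_opSpace hf)]; exact h1.smul _

end FiniteRank

/-! ### Compressions to finite-dimensional subspaces -/

section Compression

variable {ι : Type*} {H : ι → Type*} [∀ α, NormedAddCommGroup (H α)]
  [∀ α, InnerProductSpace ℂ (H α)]

/-- The span in `H α` of the vectors of a finite set that lie in `H α`. -/
def blockSpan (s : Finset (Σ α, H α)) (α : ι) : Submodule ℂ (H α) :=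
  Submodule.span ℂ {v | ⟨α, v⟩ ∈ s}

instance (s : Finset (Σ α, H α)) (α : ι) : FiniteDimensional ℂ (blockSpan s α) :=
  FiniteDimensional.span_of_finite ℂ
    (s.finite_toSet.preimage (f := fun v : H α => (⟨α, v⟩ : Σ α, H α)) sigma_mk_injective.injOn)

theorem mem_blockSpan {s : Finset (Σ α, H α)} {α : ι} {v : H α} (h : ⟨α, v⟩ ∈ s) :
    v ∈ blockSpan s α := Submodule.subset_span h

/-- The compression of a function by the projections `e` onto the subspaces `blockSpan s α`: on
functions of operators `T`, this is `T ↦ eTe`. -/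
def compress (s : Finset (Σ α, H α)) (f : BddFun H) : BddFun H :=
  ofQuad (fun α v => quad f α ((blockSpan s α).starProjection v)) ‖f‖ fun α v =>
    (abs_quad_le f α _).trans (by
      gcongr
      exact (blockSpan s α).norm_starProjection_apply_le v)

theorem quad_compress (s : Finset (Σ α, H α)) (f : BddFun H) (α : ι) (v : H α) :
    quad (compress s f) α v = quad f α ((blockSpan s α).starProjection v) :=
  quad_ofQuad _ _ _ (fun α c v => by rw [map_smul, quad_smul_right]) α v

theorem norm_compress_le (s : Finset (Σ α, H α)) (f : BddFun H) : ‖compress s f‖ ≤ ‖f‖ :=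
  BddFun.norm_le_of_quad (norm_nonneg _) fun α v => by
    rw [quad_compress]
    refine (abs_quad_le f α _).trans ?_
    gcongr
    exact (blockSpan s α).norm_starProjection_apply_le v

/-- `compress s` as a continuous linear map. -/
def compressCLM (s : Finset (Σ α, H α)) : BddFun H →L[ℝ] BddFun H :=
  LinearMap.mkContinuous
    { toFun := compress s
      map_add' := fun f g => BddFun.ext_quad fun α v => by
        simp only [quad_compress, lp.coeFn_add, quad_add]
      map_smul' := fun t f => BddFun.ext_quad fun α v => by
        simp only [quad_compress, lp.coeFn_smul, quad_smul, RingHom.id_apply] } 1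
    fun f => by rw [one_mul]; exact norm_compress_le s f

@[simp] theorem compressCLM_apply (s : Finset (Σ α, H α)) (f : BddFun H) :
    compressCLM s f = compress s f := rfl

theorem quad_compress_of_mem {s : Finset (Σ α, H α)} {α : ι} {v : H α} (h : v ∈ blockSpan s α)
    (f : BddFun H) : quad (compress s f) α v = quad f α v := by
  rw [quad_compress, Submodule.starProjection_eq_self_iff.2 h]

theorem compress_vecFun {s : Finset (Σ α, H α)} {α : ι} {u : H α} (h : u ∈ blockSpan s α) :
    compress s (vecFun α u) = vecFun α u :=
  BddFun.ext_quad fun β v => by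
    rw [quad_compress]
    by_cases hαβ : α = β
    · subst hαβ
      rw [quad_vecFun, quad_vecFun, ← Submodule.inner_starProjection_left_eq_right,
        Submodule.starProjection_eq_self_iff.2 h]
    · rw [quad_vecFun_of_ne hαβ, quad_vecFun_of_ne hαβ]

theorem exists_compress_eq {f : BddFun H} (hf : f ∈ (pureProb H).A00) :
    ∃ s, ∀ s', s ⊆ s' → compress s' f = f := by
  classical
  refine A00_induction (C := fun f => ∃ s, ∀ s', s ⊆ s' → compress s' f = f)
    (fun α u => ⟨{⟨α, u⟩}, fun s' hs => ?_⟩) ⟨∅, fun s' _ => (compressCLM s').map_zero⟩ ?_ ?_ hf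
  · exact compress_vecFun (mem_blockSpan (hs (Finset.mem_singleton_self _)))
  · rintro f g - - ⟨s, hs⟩ ⟨t, ht⟩
    refine ⟨s ∪ t, fun s' h => ?_⟩
    rw [← compressCLM_apply, map_add, compressCLM_apply, compressCLM_apply,
      hs s' (Finset.union_subset_left h), ht s' (Finset.union_subset_right h)]
  · rintro t f - ⟨s, hs⟩
    refine ⟨s, fun s' h => ?_⟩
    rw [← compressCLM_apply, map_smul, compressCLM_apply, hs s' h]

theorem blockSpan_eq_bot {s : Finset (Σ α, H α)} {α : ι} (h : ∀ x ∈ s, x.1 ≠ α) :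
    blockSpan s α = ⊥ := by
  rw [blockSpan, Submodule.span_eq_bot]
  intro v hv
  exact absurd rfl (h _ hv)

theorem quad_sum {κ : Type*} (t : Finset κ) (F : κ → BddFun H) (α : ι) (v : H α) :
    quad (∑ k ∈ t, F k : BddFun H) α v = ∑ k ∈ t, quad (F k) α v :=
  map_sum (quadCLM α v) F t

/-- Compressions have finite rank. -/
theorem compress_mem_A00 (s : Finset (Σ α, H α)) {f : BddFun H} (hf : f ∈ opSpace H) :
    compress s f ∈ (pureProb H).A00 := by
  classical
  let b : ∀ α, OrthonormalBasis _ ℂ (blockSpan s α) := fun α => stdOrthonormalBasis ℂ _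
  have h : compress s f = ∑ α ∈ s.image Sigma.fst, ∑ j,
      rankTwoFun α ((blockSpan s α).starProjection (op f α (b α j))) (b α j) := by
    refine BddFun.ext_quad fun β v => ?_
    rw [quad_compress, quad_sum]
    simp only [quad_sum]
    by_cases hβ : β ∈ s.image Sigma.fst
    · rw [Finset.sum_eq_single_of_mem β hβ fun α _ hα => Finset.sum_eq_zero fun j _ =>
        quad_rankTwoFun_of_ne hα _ _ _]
      simp only [quad_rankTwoFun]
      rw [← (isOp_op hf β).re_inner, ← re_sum]
      congr 1
      conv_lhs => rw [(b β).starProjection_eq_sum_rankOne]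
      conv_lhs =>
        enter [3]
        rw [sum_apply, map_sum]
      rw [inner_sum, ← (b β).starProjection_eq_sum_rankOne]
      refine Finset.sum_congr rfl fun j _ => ?_
      rw [InnerProductSpace.rankOne_apply, map_smul, inner_smul_right,
        Submodule.inner_starProjection_left_eq_right, mul_comm]
    · have hbot : blockSpan s β = ⊥ := blockSpan_eq_bot fun x hx hxβ =>
        hβ (Finset.mem_image.2 ⟨x, hx, hxβ⟩)
      have h0 : (blockSpan s β).starProjection v = 0 := by
        rw [← Submodule.mem_bot ℂ, ← hbot]
        exact (blockSpan s β).starProjection_apply_mem v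
      rw [h0, quad_zero_right]
      refine (Finset.sum_eq_zero fun α hα => Finset.sum_eq_zero fun j _ =>
        quad_rankTwoFun_of_ne ?_ _ _ _).symm
      rintro rfl
      exact hβ hα
  rw [h]
  exact sum_mem fun α _ => sum_mem fun j _ => rankTwoFun_mem _ _ _

end Compression

/-! ### Approximation of functionals by compressions -/

section Compressions

variable {X S : Type*} [NormedAddCommGroup X] [NormedSpace ℝ X]

/-- Suppose that adding `t (b - C b)` increases the norm of a fixed point of a compression `C` only
to second order in `t`. Then every functional is approximated in norm by its compressions: if `φ`
almost attains its norm at a fixed point `a`, it is small on the elements `b - C b`, since otherwise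
moving `a` in such a direction would exceed the norm. -/
theorem exists_norm_sub_comp_le (C : S → X →L[ℝ] X) {D : Set X} (hD : Dense D)
    (hfix : ∀ a ∈ D, ∃ s, C s a = a)
    (hC : ∀ s a b, C s a = a → ‖a‖ ≤ 1 → ‖b‖ ≤ 1 → ∀ t : ℝ, 0 ≤ t → t ≤ 1 / 2 →
      ‖a + t • (b - C s b)‖ ≤ 1 + 2 * t ^ 2)
    (φ : StrongDual ℝ X) {ε : ℝ} (hε : 0 < ε) : ∃ s, ‖φ - φ.comp (C s)‖ ≤ ε := by
  set N := ‖φ‖ with hN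
  have hN0 : 0 ≤ N := norm_nonneg _
  -- If `φ a > ‖φ‖ - t²`, comparing `φ (a + t (b - C b))` with `‖φ‖ (1 + 2t²)` bounds
  -- `φ (b - C b)` by `t (1 + 2 ‖φ‖)`.
  set t := min (1 / 2) (ε / (1 + 2 * N)) with ht
  have ht0 : 0 < t := lt_min (by norm_num) (by positivity)
  have ht2 : t ≤ 1 / 2 := min_le_left _ _
  have ht3 : t * (1 + 2 * N) ≤ ε := by
    rw [← le_div_iff₀ (by positivity)]; exact min_le_right _ _
  obtain ⟨x, hx1, hx2⟩ : ∃ x, ‖x‖ < 1 ∧ N - t ^ 2 < φ x := by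
    obtain ⟨x, hx1, hx2⟩ := φ.exists_lt_apply_of_lt_opNorm (r := N - t ^ 2)
      (by have := pow_pos ht0 2; linarith)
    rw [Real.norm_eq_abs, lt_abs] at hx2
    rcases hx2 with h | h
    · exact ⟨x, hx1, h⟩
    · exact ⟨-x, by rwa [norm_neg], by rwa [map_neg]⟩
  obtain ⟨a, haD, ha1, ha2⟩ : ∃ a ∈ D, ‖a‖ < 1 ∧ N - t ^ 2 < φ a := by
    have ho : IsOpen {x : X | ‖x‖ < 1 ∧ N - t ^ 2 < φ x} :=
      (isOpen_lt continuous_norm continuous_const).inter (isOpen_lt continuous_const φ.continuous)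
    exact hD.exists_mem_open ho ⟨x, hx1, hx2⟩
  obtain ⟨s, hs⟩ := hfix a haD
  refine ⟨s, ContinuousLinearMap.opNorm_le_of_unit_norm hε.le ?_⟩
  have key : ∀ b : X, ‖b‖ = 1 → (φ - φ.comp (C s)) b ≤ ε := fun b hb => by
    have h1 := hC s a b hs ha1.le hb.le t ht0.le ht2
    have h2 := (le_abs_self _).trans (φ.le_of_opNorm_le le_rfl (a + t • (b - C s b)))
    rw [map_add, map_smul, map_sub, smul_eq_mul, ← hN] at h2
    have h3 := mul_le_mul_of_nonneg_left h1 hN0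
    have h4 : t * (φ b - φ (C s b)) ≤ t * (t * (1 + 2 * N)) := by nlinarith
    exact (le_of_mul_le_mul_left h4 ht0).trans ht3
  intro b hb
  rw [Real.norm_eq_abs, abs_le]
  refine ⟨?_, key b hb⟩
  have h := key (-b) (by rwa [norm_neg])
  rw [map_neg] at h
  linarith

end Compressions

/-! ### Evaluations at pure states span a dense subspace of the dual -/

section Predual

variable {ι : Type*} {H : ι → Type*} [∀ α, NormedAddCommGroup (H α)]
  [∀ α, InnerProductSpace ℂ (H α)]

theorem abs_polar_quad_le {f : BddFun H} (hf : f ∈ opSpace H) (α : ι) (u v : H α) :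
    |polar (quad f α) u v| ≤ 2 * (‖f‖ * (‖u‖ * ‖v‖)) := by
  rw [(isOp_op hf α).polar, abs_mul, abs_two]
  gcongr
  calc _ ≤ ‖inner ℂ u (op f α v)‖ := abs_re_le_norm _
    _ ≤ ‖u‖ * ‖op f α v‖ := norm_inner_le_norm _ _
    _ ≤ ‖u‖ * (‖f‖ * ‖v‖) := by
      gcongr
      exact (op f α).le_of_opNorm_le (norm_op_le f α) v
    _ = _ := by ring

/-- If `a = eae` for a projection `e`, then adding a small multiple of the part of `b` outside the
corner `ebe` increases the norm of `a` only to second order. -/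
theorem norm_add_smul_sub_compress_le {s : Finset (Σ α, H α)} {a b : BddFun H}
    (ha : compress s a = a) (ha1 : ‖a‖ ≤ 1) (hb : b ∈ opSpace H) (hb1 : ‖b‖ ≤ 1) {t : ℝ}
    (ht : 0 ≤ t) (ht2 : t ≤ 1 / 2) : ‖a + t • (b - compress s b)‖ ≤ 1 + 2 * t ^ 2 := by
  refine BddFun.norm_le_of_quad (by nlinarith [sq_nonneg t]) fun α v => ?_
  -- Split `v = x + y` along the projection. The claim becomes
  -- `‖x‖² + t (2 ‖x‖ ‖y‖ + ‖y‖²) ≤ (1 + 2t²) (‖x‖² + ‖y‖²)`, which holds as `t + 1/2 ≤ 1`.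
  set x := (blockSpan s α).starProjection v with hx
  set y := v - x with hy
  have hv : x + y = v := by rw [hy]; abel
  have hn : ‖v‖ ^ 2 = ‖x‖ ^ 2 + ‖y‖ ^ 2 := by
    have h := Submodule.norm_sq_eq_add_norm_sq_starProjection v (blockSpan s α)
    rw [Submodule.starProjection_orthogonal_val] at h
    exact h
  have h1 : quad (a + t • (b - compress s b) : BddFun H) α v =
      quad a α x + t * (polar (quad b α) x y + quad b α y) := by
    rw [lp.coeFn_add, quad_add, lp.coeFn_smul, quad_smul, lp.coeFn_sub, quad_sub, quad_compress,
      polar, hv, ← hx]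
    nth_rw 1 [← ha]
    rw [quad_compress, ← hx]
    ring
  have h2 : |quad a α x| ≤ ‖x‖ ^ 2 := (abs_quad_le a α x).trans
    (mul_le_of_le_one_left (sq_nonneg _) ha1)
  have h3 : |quad b α y| ≤ ‖y‖ ^ 2 := (abs_quad_le b α y).trans
    (mul_le_of_le_one_left (sq_nonneg _) hb1)
  have h4 : |polar (quad b α) x y| ≤ 2 * (‖x‖ * ‖y‖) := (abs_polar_quad_le hb α x y).trans
    (mul_le_mul_of_nonneg_left (mul_le_of_le_one_left (by positivity) hb1) zero_le_two)
  rw [h1, hn]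
  calc _ ≤ |quad a α x| + t * (|polar (quad b α) x y| + |quad b α y|) := by
        refine (abs_add_le _ _).trans ?_
        rw [abs_mul, abs_of_nonneg ht]
        gcongr
        exact abs_add_le _ _
    _ ≤ ‖x‖ ^ 2 + t * (2 * (‖x‖ * ‖y‖) + ‖y‖ ^ 2) := by gcongr
    _ ≤ (1 + 2 * t ^ 2) * (‖x‖ ^ 2 + ‖y‖ ^ 2) := by
        nlinarith [sq_nonneg (2 * t * ‖x‖ - ‖y‖), mul_nonneg (sub_nonneg.2 ht2) (sq_nonneg ‖y‖),
          mul_nonneg (sq_nonneg t) (sq_nonneg ‖y‖)]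

/-- The functional `a ↦ quad (J a) α v` on a space `X` of functions on the pure states, embedded
by `J`: the multiple by `‖v‖²` of the evaluation at the pure state given by `v`. -/
def quadDual {X : Type*} [NormedAddCommGroup X] [NormedSpace ℝ X] (J : X →ₗᵢ[ℝ] BddFun H)
    (α : ι) (v : H α) : StrongDual ℝ X :=
  (quadCLM α v).comp J.toContinuousLinearMap

@[simp] theorem quadDual_apply {X : Type*} [NormedAddCommGroup X] [NormedSpace ℝ X]
    (J : X →ₗᵢ[ℝ] BddFun H) (α : ι) (v : H α) (a : X) :
    quadDual J α v a = quad (J a) α v := rfl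

variable {X : Type*} [NormedAddCommGroup X] [NormedSpace ℝ X] {J : X →ₗᵢ[ℝ] BddFun H}

theorem exists_map_eq_compress (hJ : Set.range J = ((pureProb H).A0 : Set (BddFun H)))
    (s : Finset (Σ α, H α)) {f : BddFun H} (hf : f ∈ opSpace H) : ∃ a, J a = compress s f := by
  have h : compress s f ∈ Set.range J := by
    rw [hJ]; exact (pureProb H).A00.le_topologicalClosure (compress_mem_A00 s hf)
  exact h

theorem dense_preimage_A00 (hJ : Set.range J = ((pureProb H).A0 : Set (BddFun H))) :
    Dense (J ⁻¹' ((pureProb H).A00 : Set (BddFun H))) := by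
  intro a
  rw [J.isometry.isEmbedding.closure_eq_preimage_closure_image, Set.mem_preimage,
    Set.image_preimage_eq_inter_range, hJ, Set.inter_eq_left.2
      (show ((pureProb H).A00 : Set (BddFun H)) ⊆ (pureProb H).A0 from
        (pureProb H).A00.le_topologicalClosure)]
  have h : J a ∈ Set.range J := ⟨a, rfl⟩
  rwa [hJ] at h

variable [∀ α, CompleteSpace (H α)]

theorem map_mem_opSpace (hJ : Set.range J = ((pureProb H).A0 : Set (BddFun H))) (a : X) :
    J a ∈ opSpace H :=
  A0_le_opSpace (by rw [← SetLike.mem_coe, ← hJ]; exact ⟨a, rfl⟩)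

theorem exists_compressOn (hJ : Set.range J = ((pureProb H).A0 : Set (BddFun H)))
    (s : Finset (Σ α, H α)) : ∃ C : X →L[ℝ] X, ∀ a, J (C a) = compress s (J a) := by
  choose c hc using fun a => exists_map_eq_compress hJ s (map_mem_opSpace hJ a)
  refine ⟨LinearMap.mkContinuous
    { toFun := c
      map_add' := fun a b => J.injective (by
        rw [map_add, hc, hc, hc, map_add]
        exact (compressCLM s).map_add _ _)
      map_smul' := fun t a => J.injective (by
        rw [map_smul, hc, hc, map_smul]
        exact (compressCLM s).map_smul _ _) } 1
    fun a => ?_, hc⟩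
  rw [one_mul, ← J.norm_map, ← J.norm_map a]
  exact (congrArg norm (hc a)).trans_le (norm_compress_le s _)

/-- The compressions as operators on a Banach space `X` identified with `𝔄₀` by the isometry
`J`. -/
def compressOn (hJ : Set.range J = ((pureProb H).A0 : Set (BddFun H)))
    (s : Finset (Σ α, H α)) : X →L[ℝ] X :=
  (exists_compressOn hJ s).choose

theorem map_compressOn (hJ : Set.range J = ((pureProb H).A0 : Set (BddFun H)))
    (s : Finset (Σ α, H α)) (a : X) : J (compressOn hJ s a) = compress s (J a) :=
  (exists_compressOn hJ s).choose_spec a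

/-- A functional on a finite-dimensional corner is a combination of evaluations at pure states,
since these separate the points of the corner, by polarization. -/
theorem comp_compressOn_mem_span (hJ : Set.range J = ((pureProb H).A0 : Set (BddFun H)))
    (s : Finset (Σ α, H α)) (φ : StrongDual ℝ X) :
    φ.comp (compressOn hJ s) ∈
      Submodule.span ℝ (Set.range fun x : Σ α, H α => quadDual J x.1 x.2) := by
  classical
  let b : ∀ α, OrthonormalBasis _ ℂ (blockSpan s α) := fun α => stdOrthonormalBasis ℂ _
  -- For an orthonormal basis `bᵢ` of each corner, evaluate at `bᵢ + bⱼ` and at `bᵢ + I bⱼ`; the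
  -- case `i = j` of the former covers the `bᵢ` themselves.
  let K := Σ α : s.image Sigma.fst, Fin (Module.finrank ℂ (blockSpan s α.1)) ×
    Fin (Module.finrank ℂ (blockSpan s α.1)) × Bool
  let x : K → Σ α, H α := fun k => ⟨k.1.1,
    (b k.1.1 k.2.1 : H k.1.1) + (if k.2.2.2 then I else 1) • (b k.1.1 k.2.2.1 : H k.1.1)⟩
  let L : K → X →ₗ[ℝ] ℝ := fun k => (quadDual J (x k).1 (x k).2 : X →L[ℝ] ℝ)
  have hker : ⨅ k, LinearMap.ker (L k) ≤
      LinearMap.ker (φ.comp (compressOn hJ s) : X →ₗ[ℝ] ℝ) := by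
    intro f hf
    rw [Submodule.mem_iInf] at hf
    have hz : ∀ k, quad (J f) (x k).1 (x k).2 = 0 := hf
    suffices h : J (compressOn hJ s f) = 0 by
      rw [LinearMap.mem_ker, ContinuousLinearMap.coe_coe, ContinuousLinearMap.comp_apply,
        (map_eq_zero_iff J J.injective).1 h, map_zero]
    refine BddFun.ext_quad fun α v => ?_
    rw [map_compressOn, quad_compress]
    refine Eq.trans ?_ (quad_zero α v).symm
    by_cases hα : α ∈ s.image Sigma.fst
    · have hT := isOp_op (map_mem_opSpace hJ f) α
      set T := op (J f) α
      have h1 : ∀ i j, quad (J f) α ((b α i : H α) + (b α j : H α)) = 0 := fun i j => by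
        have := hz ⟨⟨α, hα⟩, i, j, false⟩
        simpa [x] using this
      have h2 : ∀ i j, quad (J f) α ((b α i : H α) + I • (b α j : H α)) = 0 := fun i j => by
        have := hz ⟨⟨α, hα⟩, i, j, true⟩
        simpa [x] using this
      have h3 : ∀ i, quad (J f) α (b α i : H α) = 0 := fun i => by
        have := h1 i i
        rw [← two_smul ℂ, quad_smul_right, norm_ofNat] at this
        linarith
      have h4 : ∀ i j, inner ℂ (b α i : H α) (T (b α j)) = 0 := fun i j => by
        have h5 := hT.polar (b α i : H α) (b α j)
        have h6 := hT.polar (b α i : H α) (I • (b α j : H α))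
        rw [polar, h1, h3, h3] at h5
        rw [polar, h2, h3, quad_smul_right, h3, map_smul, inner_smul_right, I_mul_re] at h6
        apply Complex.ext
        · rw [zero_re]; linarith
        · rw [zero_im]; linarith
      rw [← hT.re_inner, (b α).starProjection_eq_sum_rankOne]
      simp only [sum_apply, InnerProductSpace.rankOne_apply, map_sum, map_smul, sum_inner,
        inner_sum, inner_smul_left, inner_smul_right, h4, mul_zero, Finset.sum_const_zero, zero_re]
    · have hbot : blockSpan s α = ⊥ := blockSpan_eq_bot fun x hx hxα =>
        hα (Finset.mem_image.2 ⟨x, hx, hxα⟩)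
      have h0 : (blockSpan s α).starProjection v = 0 := by
        rw [← Submodule.mem_bot ℂ, ← hbot]
        exact (blockSpan s α).starProjection_apply_mem v
      rw [h0, quad_zero_right]
  obtain ⟨c, hc⟩ := (Submodule.mem_span_range_iff_exists_fun ℝ).1 (mem_span_of_iInf_ker_le_ker hker)
  have h : φ.comp (compressOn hJ s) = ∑ k, c k • quadDual J (x k).1 (x k).2 := by
    ext f
    have := LinearMap.congr_fun hc f
    simp only [LinearMap.sum_apply, LinearMap.smul_apply] at this
    rw [sum_apply]
    exact this.symm
  rw [h]
  exact sum_mem fun k _ => Submodule.smul_mem _ _ (Submodule.subset_span ⟨x k, rfl⟩)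

/-- The evaluations at pure states span a norm dense subspace of the dual of `𝔄₀`. -/
theorem dense_span_quadDual (hJ : Set.range J = ((pureProb H).A0 : Set (BddFun H))) :
    Dense (Submodule.span ℝ (Set.range fun x : Σ α, H α => quadDual J x.1 x.2) :
      Set (StrongDual ℝ X)) := by
  intro φ
  rw [Metric.mem_closure_iff]
  intro ε hε
  obtain ⟨s, hs⟩ := exists_norm_sub_comp_le (compressOn hJ) (dense_preimage_A00 hJ)
    (fun a ha => by
      obtain ⟨s, hs⟩ := exists_compress_eq ha
      exact ⟨s, J.injective (by rw [map_compressOn, hs s subset_rfl])⟩)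
    (fun s a b ha ha1 hb1 t ht ht2 => by
      rw [← J.norm_map, map_add, map_smul, map_sub, map_compressOn]
      exact norm_add_smul_sub_compress_le (by rw [← map_compressOn hJ, ha])
        (by rwa [J.norm_map]) (map_mem_opSpace hJ b) (by rwa [J.norm_map]) ht ht2) φ (half_pos hε)
  exact ⟨_, comp_compressOn_mem_span hJ s φ, by rw [dist_eq_norm]; linarith⟩

end Predual

open Filter Topology

/-! ### The bidual -/

section Bidual

variable {ι : Type*} {H : ι → Type*} [∀ α, NormedAddCommGroup (H α)]
  [∀ α, InnerProductSpace ℂ (H α)]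
  {X : Type*} [NormedAddCommGroup X] [NormedSpace ℝ X] {J : X →ₗᵢ[ℝ] BddFun H}

theorem norm_quadDual_le (α : ι) (v : H α) : ‖quadDual J α v‖ ≤ ‖v‖ ^ 2 :=
  ContinuousLinearMap.opNorm_le_bound _ (sq_nonneg _) fun a => by
    rw [quadDual_apply, mul_comm, ← J.norm_map]; exact abs_quad_le (J a) α v

variable (J) in
/-- The function on the pure states given by an element of the bidual of `𝔄₀`, through its values
at the evaluation functionals. -/
def bidualFun (x : StrongDual ℝ (StrongDual ℝ X)) : BddFun H :=
  ofQuad (fun α v => x (quadDual J α v)) ‖x‖ fun α v =>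
    (x.le_opNorm _).trans (mul_le_mul_of_nonneg_left (norm_quadDual_le α v) (norm_nonneg x))

theorem quad_bidualFun (x : StrongDual ℝ (StrongDual ℝ X)) (α : ι) (v : H α) :
    quad (bidualFun J x) α v = x (quadDual J α v) := by
  refine quad_ofQuad _ _ _ (fun α c v => ?_) α v
  have h : quadDual J α (c • v) = ‖c‖ ^ 2 • quadDual J α v := by
    ext a
    simp only [quadDual_apply, quad_smul_right, smul_apply, smul_eq_mul]
  rw [h, map_smul, smul_eq_mul]

theorem bidualFun_add (x y : StrongDual ℝ (StrongDual ℝ X)) :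
    bidualFun J (x + y) = bidualFun J x + bidualFun J y :=
  BddFun.ext_quad fun α v => by
    rw [lp.coeFn_add, quad_add, quad_bidualFun, quad_bidualFun, quad_bidualFun, add_apply]

theorem bidualFun_smul (t : ℝ) (x : StrongDual ℝ (StrongDual ℝ X)) :
    bidualFun J (t • x) = t • bidualFun J x :=
  BddFun.ext_quad fun α v => by
    rw [lp.coeFn_smul, quad_smul, quad_bidualFun, quad_bidualFun, smul_apply, smul_eq_mul]

theorem norm_bidualFun_le (x : StrongDual ℝ (StrongDual ℝ X)) : ‖bidualFun J x‖ ≤ ‖x‖ :=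
  BddFun.norm_le_of_quad (norm_nonneg _) fun α v => by
    rw [quad_bidualFun]
    exact (x.le_opNorm _).trans (mul_le_mul_of_nonneg_left (norm_quadDual_le α v) (norm_nonneg x))

theorem bidualFun_inclusion (a : X) :
    bidualFun J (NormedSpace.inclusionInDoubleDual ℝ X a) = J a :=
  BddFun.ext_quad fun α v => by
    rw [quad_bidualFun, NormedSpace.dual_def, quadDual_apply]

/-- Every function of a bounded family of self-adjoint operators comes from the bidual: a weak-star
cluster point of its compressions does, as the compressions eventually agree with it at each pure
state. -/
theorem exists_bidualFun_eq (hJ : Set.range J = ((pureProb H).A0 : Set (BddFun H)))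
    {f : BddFun H} (hf : f ∈ opSpace H) :
    ∃ x : StrongDual ℝ (StrongDual ℝ X), bidualFun J x = f ∧ ‖x‖ ≤ ‖f‖ ∧
      StrongDual.toWeakDual x ∈ closure (Set.range fun a : X =>
        StrongDual.toWeakDual (NormedSpace.inclusionInDoubleDual ℝ X a)) := by
  classical
  -- The compressions of `f`, as a net in a ball of the bidual indexed by finite sets of vectors.
  choose a ha using fun s => exists_map_eq_compress hJ s hf
  let y : Finset (Σ α, H α) → WeakDual ℝ (StrongDual ℝ X) := fun s =>
    StrongDual.toWeakDual (NormedSpace.inclusionInDoubleDual ℝ X (a s))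
  have hy : ∀ s, y s ∈ WeakDual.toStrongDual ⁻¹'
      Metric.closedBall (0 : StrongDual ℝ (StrongDual ℝ X)) ‖f‖ := fun s => by
    rw [Set.mem_preimage, mem_closedBall_zero_iff]
    refine (NormedSpace.double_dual_bound ℝ X (a s)).trans ?_
    rw [← J.norm_map, ha]
    exact norm_compress_le s f
  obtain ⟨x, hx, hxy⟩ := (WeakDual.isCompact_closedBall (𝕜 := ℝ)
    (0 : StrongDual ℝ (StrongDual ℝ X)) ‖f‖).exists_mapClusterPt (f := atTop) (u := y)
    (tendsto_principal.2 (Eventually.of_forall hy))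
  refine ⟨WeakDual.toStrongDual x, BddFun.ext_quad fun α v => ?_, ?_, ?_⟩
  · have hc : IsClosed {z : WeakDual ℝ (StrongDual ℝ X) | z (quadDual J α v) = quad f α v} :=
      isClosed_eq (WeakDual.eval_continuous _) continuous_const
    have hev : ∀ᶠ s in atTop, y s (quadDual J α v) = quad f α v := by
      filter_upwards [eventually_ge_atTop ({⟨α, v⟩} : Finset (Σ α, H α))] with s hs
      change quad (J (a s)) α v = _
      rw [ha, quad_compress_of_mem (mem_blockSpan (hs (Finset.mem_singleton_self _)))]
    rw [quad_bidualFun]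
    exact isClosed_iff_clusterPt.1 hc x (ClusterPt.mono hxy (le_principal_iff.2 hev))
  · simpa using hx
  · rw [mem_closure_iff_clusterPt]
    exact ClusterPt.mono hxy (tendsto_principal.2 (Eventually.of_forall fun s => ⟨a s, rfl⟩))

variable [∀ α, CompleteSpace (H α)]

theorem bidualFun_mem_opSpace (hJ : Set.range J = ((pureProb H).A0 : Set (BddFun H)))
    (x : StrongDual ℝ (StrongDual ℝ X)) : bidualFun J x ∈ opSpace H := by
  rw [mem_opSpace_iff]
  have h : ∀ α u v, polar (quad (bidualFun J x) α) u v = x (polar (quadDual J α) u v) :=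
    fun α u v => by
      simp only [polar, quad_bidualFun, map_sub]
  have h' : ∀ α u v a, polar (quadDual J α) u v a = polar (quad (J a) α) u v :=
    fun α u v a => rfl
  refine fun α => ⟨fun u v w => ?_, fun t u v => ?_⟩
  · rw [h, h, h, ← map_add]
    congr 1
    ext a
    rw [add_apply, h', h', h', (mem_opSpace_iff.1 (map_mem_opSpace hJ a) α).1]
  · rw [h, h, ← smul_eq_mul, ← map_smul]
    congr 1
    ext a
    rw [smul_apply, h', h', (mem_opSpace_iff.1 (map_mem_opSpace hJ a) α).2, smul_eq_mul]

theorem bidualFun_injective (hJ : Set.range J = ((pureProb H).A0 : Set (BddFun H))) :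
    Function.Injective (bidualFun J) := fun x y h => by
  refine ContinuousLinearMap.ext_on (dense_span_quadDual hJ) ?_
  rintro _ ⟨⟨α, v⟩, rfl⟩
  simp only
  rw [← quad_bidualFun, ← quad_bidualFun, h]

theorem norm_bidualFun (hJ : Set.range J = ((pureProb H).A0 : Set (BddFun H)))
    (x : StrongDual ℝ (StrongDual ℝ X)) : ‖bidualFun J x‖ = ‖x‖ := by
  refine le_antisymm (norm_bidualFun_le x) ?_
  obtain ⟨y, hy, hn, -⟩ := exists_bidualFun_eq hJ (bidualFun_mem_opSpace hJ x)
  rwa [bidualFun_injective hJ hy] at hn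

theorem dense_inclusionInDoubleDual (hJ : Set.range J = ((pureProb H).A0 : Set (BddFun H))) :
    DenseRange fun a : X =>
      StrongDual.toWeakDual (NormedSpace.inclusionInDoubleDual ℝ X a) := fun x => by
  obtain ⟨y, hy, -, hn⟩ := exists_bidualFun_eq hJ
    (bidualFun_mem_opSpace hJ (WeakDual.toStrongDual x))
  rw [bidualFun_injective hJ hy] at hn
  exact hn

/-- The Jordan product of operators, transported to the bidual of `𝔄₀`. -/
def bidualMul (hJ : Set.range J = ((pureProb H).A0 : Set (BddFun H)))
    (x y : StrongDual ℝ (StrongDual ℝ X)) : StrongDual ℝ (StrongDual ℝ X) :=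
  (exists_bidualFun_eq hJ (jmul_mem_opSpace (bidualFun_mem_opSpace hJ x)
    (bidualFun_mem_opSpace hJ y))).choose

theorem bidualFun_bidualMul (hJ : Set.range J = ((pureProb H).A0 : Set (BddFun H)))
    (x y : StrongDual ℝ (StrongDual ℝ X)) :
    bidualFun J (bidualMul hJ x y) = jmul (bidualFun J x) (bidualFun J y) :=
  (exists_bidualFun_eq hJ (jmul_mem_opSpace (bidualFun_mem_opSpace hJ x)
    (bidualFun_mem_opSpace hJ y))).choose_spec.1

theorem isJBProduct_bidualMul (hJ : Set.range J = ((pureProb H).A0 : Set (BddFun H))) :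
    IsJBProduct (bidualMul hJ) where
  add_left a b c := bidualFun_injective hJ (by
    rw [bidualFun_add, bidualFun_bidualMul, bidualFun_bidualMul, bidualFun_bidualMul,
      bidualFun_add, jmul_add_left (bidualFun_mem_opSpace hJ a) (bidualFun_mem_opSpace hJ b)])
  smul_left t a b := bidualFun_injective hJ (by
    rw [bidualFun_smul, bidualFun_bidualMul, bidualFun_bidualMul, bidualFun_smul,
      jmul_smul_left t (bidualFun_mem_opSpace hJ a)])
  comm a b := bidualFun_injective hJ (by
    rw [bidualFun_bidualMul, bidualFun_bidualMul, jmul_comm])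
  jordan a b := bidualFun_injective hJ (by
    simp only [bidualFun_bidualMul]
    exact jmul_jordan (bidualFun_mem_opSpace hJ a) (bidualFun_mem_opSpace hJ b))
  complete := inferInstance
  norm_mul_le a b := by
    rw [← norm_bidualFun hJ, ← norm_bidualFun hJ a, ← norm_bidualFun hJ b, bidualFun_bidualMul]
    exact norm_jmul_le _ _
  norm_sq a := by
    rw [← norm_bidualFun hJ, ← norm_bidualFun hJ a, bidualFun_bidualMul]
    exact norm_jmul_self (bidualFun_mem_opSpace hJ a)
  norm_sq_le a b := by
    rw [← norm_bidualFun hJ, ← norm_bidualFun hJ (_ + _), bidualFun_add, bidualFun_bidualMul,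
      bidualFun_bidualMul]
    exact norm_jmul_self_le _ _

theorem bidualMul_inclusion (hJ : Set.range J = ((pureProb H).A0 : Set (BddFun H))) {a b c : X}
    (h : J c = jmul (J a) (J b)) :
    bidualMul hJ (NormedSpace.inclusionInDoubleDual ℝ X a)
      (NormedSpace.inclusionInDoubleDual ℝ X b) = NormedSpace.inclusionInDoubleDual ℝ X c :=
  bidualFun_injective hJ (by
    rw [bidualFun_bidualMul, bidualFun_inclusion, bidualFun_inclusion, bidualFun_inclusion, h])

/-- Multiplication by an element of the bidual is the adjoint of an operator on the dual of `𝔄₀`. For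
evaluation at a vector `v`, this is polarization of `Re ⟨Tv, w⟩`, and these evaluations span a dense
subspace. -/
theorem exists_predual_bidualMul (hJ : Set.range J = ((pureProb H).A0 : Set (BddFun H)))
    (y : StrongDual ℝ (StrongDual ℝ X)) :
    ∃ L : StrongDual ℝ X →L[ℝ] StrongDual ℝ X, ∀ x φ, bidualMul hJ x y φ = x (L φ) := by
  have hm := isJBProduct_bidualMul hJ
  let M : StrongDual ℝ (StrongDual ℝ X) →L[ℝ] StrongDual ℝ (StrongDual ℝ X) :=
    LinearMap.mkContinuous
      { toFun := fun x => bidualMul hJ x y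
        map_add' := fun a b => hm.add_left a b y
        map_smul' := fun t a => hm.smul_left t a y } ‖y‖
      fun x => by rw [mul_comm]; exact hm.norm_mul_le x y
  let L : StrongDual ℝ X →L[ℝ] StrongDual ℝ X :=
    (M.comp (NormedSpace.inclusionInDoubleDual ℝ X)).flip
  refine ⟨L, fun x φ => ?_⟩
  have h : bidualMul hJ x y = x.comp L := by
    refine ContinuousLinearMap.ext_on (dense_span_quadDual hJ) ?_
    rintro _ ⟨⟨α, v⟩, rfl⟩
    set w := op (bidualFun J y) α v with hw
    have hre : ∀ z : StrongDual ℝ (StrongDual ℝ X), bidualMul hJ z y (quadDual J α v) =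
        1 / 2 * polar (quad (bidualFun J z) α) v w := fun z => by
      have hz := isOp_op (bidualFun_mem_opSpace hJ z) α
      rw [← quad_bidualFun, bidualFun_bidualMul, quad_jmul, hz.inner_left, hz.polar, ← hw]
      ring
    have hL : L (quadDual J α v) = (1 / 2 : ℝ) • polar (quadDual J α) v w := by
      ext a
      refine (hre (NormedSpace.inclusionInDoubleDual ℝ X a)).trans ?_
      rw [bidualFun_inclusion]; rfl
    change _ = x (L (quadDual J α v))
    rw [hL, map_smul, smul_eq_mul]
    refine (hre x).trans ?_
    simp only [polar, quad_bidualFun, map_sub]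
  rw [h]; rfl

theorem separatelyWeakStarContinuous_bidualMul
    (hJ : Set.range J = ((pureProb H).A0 : Set (BddFun H))) :
    SeparatelyWeakStarContinuous (bidualMul hJ) := by
  have h : ∀ y, WeakStarContinuous fun x => bidualMul hJ x y := fun y => by
    obtain ⟨L, hL⟩ := exists_predual_bidualMul hJ y
    refine WeakDual.continuous_of_continuous_eval fun φ => ?_
    exact (WeakDual.eval_continuous (L φ)).congr fun x => (hL (WeakDual.toStrongDual x) φ).symm
  refine ⟨fun x => ?_, h⟩
  simp only [(isJBProduct_bidualMul hJ).comm x]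
  exact h x

/-- A separately weak-star continuous map on the bidual is determined by its values on the weak-star
dense subspace `𝔄₀`. -/
theorem eq_of_separatelyWeakStarContinuous
    (hJ : Set.range J = ((pureProb H).A0 : Set (BddFun H)))
    {m n : StrongDual ℝ (StrongDual ℝ X) → StrongDual ℝ (StrongDual ℝ X) →
      StrongDual ℝ (StrongDual ℝ X)}
    (hm : SeparatelyWeakStarContinuous m) (hn : SeparatelyWeakStarContinuous n)
    (h : ∀ a b, m (NormedSpace.inclusionInDoubleDual ℝ X a)
      (NormedSpace.inclusionInDoubleDual ℝ X b) = n (NormedSpace.inclusionInDoubleDual ℝ X a)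
      (NormedSpace.inclusionInDoubleDual ℝ X b)) : m = n := by
  have hd := dense_inclusionInDoubleDual hJ
  have h1 : ∀ a y, m (NormedSpace.inclusionInDoubleDual ℝ X a) y =
      n (NormedSpace.inclusionInDoubleDual ℝ X a) y := fun a y =>
    StrongDual.toWeakDual.injective (congrFun (hd.equalizer (hm.1 _) (hn.1 _)
      (funext fun b => congrArg StrongDual.toWeakDual (h a b))) (StrongDual.toWeakDual y))
  funext x y
  exact StrongDual.toWeakDual.injective (congrFun (hd.equalizer (hm.2 y) (hn.2 y)
    (funext fun a => congrArg StrongDual.toWeakDual (h1 a y))) (StrongDual.toWeakDual x))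

end Bidual

/-! ### Orthogonal decompositions -/

section HilbertSum

variable {E : Type*} [NormedAddCommGroup E] [InnerProductSpace ℂ E]

theorem inner_starProjection_self (K : Submodule ℂ E) [K.HasOrthogonalProjection] (v : E) :
    inner ℂ (K.starProjection v) (K.starProjection v) = inner ℂ v (K.starProjection v) := by
  rw [Submodule.inner_starProjection_left_eq_right,
    Submodule.starProjection_eq_self_iff.2 (K.starProjection_apply_mem v)]

theorem hasSum_norm_sq_starProjection {J : Type*} (F : J → Submodule ℂ E)
    [∀ j, CompleteSpace (F j)] {v : E} (h : HasSum (fun j => (F j).starProjection v) v) :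
    HasSum (fun j => ‖(F j).starProjection v‖ ^ 2) (‖v‖ ^ 2) := by
  have h1 := (h.mapL (innerSL ℂ v)).mapL reCLM
  have h2 : reCLM (innerSL ℂ v v) = ‖v‖ ^ 2 := by
    rw [innerSL_apply_apply, inner_self_eq_norm_sq_to_K]
    norm_cast
  rw [h2] at h1
  refine h1.congr_fun fun j => ?_
  rw [innerSL_apply_apply, ← inner_starProjection_self, inner_self_eq_norm_sq_to_K]
  norm_cast

theorem hasSum_starProjection [CompleteSpace E] {J : Type*} (F : J → Submodule ℂ E) [∀ j, CompleteSpace (F j)]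
    (hF : ∀ i j, i ≠ j → ∀ u ∈ F i, ∀ v ∈ F j, inner ℂ u v = 0)
    (htop : (⨆ j, F j)ᗮ = ⊥) (v : E) : HasSum (fun j => (F j).starProjection v) v := by
  have hO : OrthogonalFamily ℂ (fun j => F j) fun j => (F j).subtypeₗᵢ :=
    fun i j hij u v => hF i j hij u u.2 v v.2
  have hS : IsHilbertSum ℂ (fun j => F j) fun j => (F j).subtypeₗᵢ :=
    IsHilbertSum.mkInternal F hO (by
      rw [top_le_iff, Submodule.topologicalClosure_eq_top_iff]; exact htop)
  have h := hS.hasSum_linearIsometryEquiv_symm (hS.linearIsometryEquiv v)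
  rw [LinearIsometryEquiv.symm_apply_apply] at h
  refine h.congr_fun fun j => ?_
  have h1 := h.mapL (F j).starProjection
  refine h1.unique ?_
  have h2 : (F j).starProjection ((F j).subtypeₗᵢ (hS.linearIsometryEquiv v j)) =
      (F j).subtypeₗᵢ (hS.linearIsometryEquiv v j) :=
    Submodule.starProjection_eq_self_iff.2 (hS.linearIsometryEquiv v j).2
  rw [← h2]
  refine hasSum_single j fun i hij => ?_
  rw [Submodule.starProjection_apply_eq_zero_iff, Submodule.mem_orthogonal]
  exact fun u hu => hF j i hij.symm u hu _ (hS.linearIsometryEquiv v i).2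

end HilbertSum

/-! ### Orthoclosed sets and their bases -/

section Rays

variable {ι : Type*} {H : ι → Type*} [∀ α, NormedAddCommGroup (H α)]
  [∀ α, InnerProductSpace ℂ (H α)]

/-- The set of the rays lying in a family of subspaces of the Hilbert spaces `H α`. -/
def rays (K : ∀ α, Submodule ℂ (H α)) : Set (PureStates H) := {σ | σ.2.rep ∈ K σ.1}

theorem mk_mem_rays {K : ∀ α, Submodule ℂ (H α)} {α : ι} {v : H α} (hv : v ≠ 0) :
    (⟨α, Projectivization.mk ℂ v hv⟩ : PureStates H) ∈ rays K ↔ v ∈ K α := by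
  obtain ⟨a, ha⟩ := Projectivization.exists_smul_eq_mk_rep ℂ v hv
  change (Projectivization.mk ℂ v hv).rep ∈ K α ↔ _
  rw [← ha]
  rw [Units.smul_def]
  exact (K α).smul_mem_iff a.ne_zero

theorem prob_mk_eq_zero_iff {α : ι} {u v : H α} (hu : u ≠ 0) (hv : v ≠ 0) :
    (pureProb H).prob ⟨α, Projectivization.mk ℂ u hu⟩ ⟨α, Projectivization.mk ℂ v hv⟩ = 0 ↔
      inner ℂ u v = 0 := by
  have hu' : ‖u‖ ≠ 0 := norm_ne_zero_iff.2 hu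
  have hv' : ‖v‖ ≠ 0 := norm_ne_zero_iff.2 hv
  rw [pureProb_same, rayProb_mk, sq_eq_zero_iff, div_eq_zero_iff]
  simp [hu, hv]

/-- The rays orthogonal to a set of rays are those in the orthogonal complements of the spans. -/
theorem orthoplement_eq_rays (Q : Set (PureStates H)) :
    (pureProb H).orthoplement Q =
      rays fun α => (Submodule.span ℂ {u | ∃ hu : u ≠ 0,
        (⟨α, Projectivization.mk ℂ u hu⟩ : PureStates H) ∈ Q})ᗮ := by
  ext ⟨α, y⟩
  induction y using Projectivization.ind with
  | h v hv =>
  rw [mk_mem_rays, Submodule.mem_orthogonal]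
  constructor
  · intro h u hu
    refine Submodule.mem_orthogonal_singleton_iff_inner_left.1
      (Submodule.span_le (p := (Submodule.span ℂ {v})ᗮ).2 ?_ hu)
    rintro u ⟨hu, huQ⟩
    exact Submodule.mem_orthogonal_singleton_iff_inner_left.2
      ((prob_mk_eq_zero_iff hu hv).1 (h _ huQ))
  · rintro h ⟨β, x⟩ hx
    by_cases hβ : β = α
    · subst hβ
      induction x using Projectivization.ind with
      | h u hu => exact (prob_mk_eq_zero_iff hu hv).2 (h u (Submodule.subset_span ⟨hu, hx⟩))
    · exact pureProb_of_ne H hβ _ _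

theorem orthoplement_rays (K : ∀ α, Submodule ℂ (H α)) :
    (pureProb H).orthoplement (rays K) = rays fun α => (K α)ᗮ := by
  rw [orthoplement_eq_rays]
  congr 1
  funext α
  congr 1
  simp only [mk_mem_rays, exists_prop]
  refine le_antisymm (Submodule.span_le.2 fun u hu => hu.2) fun u hu => ?_
  by_cases h : u = 0
  · rw [h]; exact zero_mem _
  · exact Submodule.subset_span ⟨h, hu⟩

theorem isOrthoclosed_rays (K : ∀ α, Submodule ℂ (H α)) [∀ α, CompleteSpace (K α)] :
    (pureProb H).IsOrthoclosed (rays K) := by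
  rw [TransitionProbability.IsOrthoclosed, orthoplement_rays, orthoplement_rays]
  simp only [Submodule.orthogonal_orthogonal]

theorem quad_probVec_starProjection {K : ∀ α, Submodule ℂ (H α)} [∀ α, CompleteSpace (K α)]
    {e : PureStates H} (he : e ∈ rays K) (α : ι) (v : H α) :
    quad ((pureProb H).probVec e) α ((K α).starProjection v) =
      quad ((pureProb H).probVec e) α v := by
  obtain ⟨β, y⟩ := e
  by_cases h : β = α
  · subst h
    induction y using Projectivization.ind with
    | h u hu =>
    rw [mk_mem_rays] at he
    rw [quad_probVec_mk, quad_probVec_mk, ← Submodule.inner_starProjection_left_eq_right,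
      Submodule.starProjection_eq_self_iff.2 he]
  · rw [quad_probVec_of_ne h, quad_probVec_of_ne h]

/-- The transition probabilities to the elements of any basis of the rays in `K` add up to the
squared norm of the projection to `K`. -/
theorem hasSum_quad_of_isBasisOf {K : ∀ α, Submodule ℂ (H α)} [∀ α, CompleteSpace (K α)]
    {B : Set (PureStates H)} (hB : (pureProb H).IsBasisOf B (rays K)) (α : ι) (v : H α) :
    HasSum (fun e : B => quad ((pureProb H).probVec e) α v) (‖(K α).starProjection v‖ ^ 2) := by
  simp only [← fun e : B => quad_probVec_starProjection (hB.subset e.2) α v]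
  have hw := (K α).starProjection_apply_mem v
  set w := (K α).starProjection v
  by_cases h : w = 0
  · rw [h]
    simp only [quad_zero_right, norm_zero, ne_eq, OfNat.ofNat_ne_zero, not_false_eq_true, zero_pow]
    exact hasSum_zero
  · have h1 := (hB.hasSum_one _ ((mk_mem_rays h).2 hw)).mul_left (‖w‖ ^ 2)
    rw [mul_one] at h1
    refine h1.congr_fun fun e => ?_
    rw [quad_of_ne _ h]; rfl

theorem hasSum_prob_of_isBasisOf {K : ∀ α, Submodule ℂ (H α)} [∀ α, CompleteSpace (K α)]
    {B : Set (PureStates H)} (hB : (pureProb H).IsBasisOf B (rays K)) (σ : PureStates H) :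
    HasSum (fun e : B => (pureProb H).prob e σ)
      (‖(K σ.1).starProjection σ.2.rep‖ ^ 2 / ‖σ.2.rep‖ ^ 2) := by
  refine ((hasSum_quad_of_isBasisOf hB σ.1 σ.2.rep).div_const (‖σ.2.rep‖ ^ 2)).congr_fun
    fun e => ?_
  exact apply_eq_quad_div _ σ

theorem exists_isBasisOf_rays (K : ∀ α, Submodule ℂ (H α)) [∀ α, CompleteSpace (K α)] :
    ∃ B, (pureProb H).IsBasisOf B (rays K) := by
  choose w b hb using fun α => exists_hilbertBasis ℂ (K α)
  have hne : ∀ α (i : w α), ((b α i : K α) : H α) ≠ 0 := fun α i h =>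
    (b α).orthonormal.ne_zero i (Subtype.ext h)
  let g : (Σ α, w α) → PureStates H := fun k =>
    ⟨k.1, Projectivization.mk ℂ ((b k.1 k.2 : K k.1) : H k.1) (hne _ _)⟩
  have hg : ∀ k l, k ≠ l → (pureProb H).prob (g k) (g l) = 0 := by
    rintro ⟨α, i⟩ ⟨β, j⟩ hkl
    by_cases h : α = β
    · subst h
      refine (prob_mk_eq_zero_iff _ _).2 ((b α).orthonormal.2 fun hij => hkl ?_)
      exact congrArg (Sigma.mk α) hij
    · exact pureProb_of_ne H h _ _
  have hinj : Function.Injective g := fun k l h => by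
    by_contra hkl
    have h0 := hg k l hkl
    rw [((pureProb H).eq_one_iff _ _).2 h] at h0
    exact one_ne_zero h0
  refine ⟨Set.range g, ?_, ?_, ?_⟩
  · rintro _ ⟨⟨α, i⟩, rfl⟩
    exact (mk_mem_rays _).2 (b α i).2
  · rintro _ ⟨k, rfl⟩ _ ⟨l, rfl⟩ h
    exact hg k l fun hkl => h (by rw [hkl])
  · rintro ⟨α, y⟩ hσ
    induction y using Projectivization.ind with
    | h v hv =>
    rw [mk_mem_rays] at hσ
    have hv' : ‖v‖ ≠ 0 := norm_ne_zero_iff.2 hv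
    rw [← (Equiv.ofInjective g hinj).hasSum_iff]
    have hα : Function.Injective (fun i : w α => (⟨α, i⟩ : Σ α, w α)) :=
      fun i j h => by cases h; rfl
    rw [← hα.hasSum_iff]
    · have h1 := ((b α).hasSum_inner_mul_inner ⟨v, hσ⟩ ⟨v, hσ⟩).mapL reCLM
      have h2 := h1.div_const (‖v‖ ^ 2)
      have h3 : reCLM (inner ℂ (⟨v, hσ⟩ : K α) ⟨v, hσ⟩) / ‖v‖ ^ 2 = 1 := by
        rw [inner_self_eq_norm_sq_to_K]
        norm_cast
        exact div_self (pow_ne_zero 2 hv')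
      rw [h3] at h2
      refine h2.congr_fun fun i => ?_
      change (pureProb H).prob (g ⟨α, i⟩) _ = _
      rw [pureProb_same, rayProb_mk]
      have h4 : ‖((b α i : K α) : H α)‖ = 1 := (b α).orthonormal.1 i
      rw [h4, one_mul, div_pow, ← inner_conj_symm (⟨v, hσ⟩ : K α), conj_mul']
      norm_cast
    · rintro ⟨β, i⟩ hi
      refine pureProb_of_ne H (fun h => hi ?_) _ _
      obtain rfl : β = α := h
      exact ⟨i, rfl⟩

variable [∀ α, CompleteSpace (H α)]

theorem exists_eq_rays {Q : Set (PureStates H)} (hQ : (pureProb H).IsOrthoclosed Q) :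
    ∃ K : ∀ α, Submodule ℂ (H α), (∀ α, CompleteSpace (K α)) ∧ Q = rays K :=
  ⟨_, fun _ => (Submodule.isClosed_orthogonal _).completeSpace_coe,
    hQ.symm.trans (orthoplement_eq_rays _)⟩

theorem hasSum_probSet {Q : Set (PureStates H)} (hQ : (pureProb H).IsOrthoclosed Q)
    {B : Set (PureStates H)} (hB : (pureProb H).IsBasisOf B Q) (σ : PureStates H) :
    HasSum (fun e : B => (pureProb H).prob e σ) ((pureProb H).probSet Q σ) := by
  obtain ⟨K, _, rfl⟩ := exists_eq_rays hQ
  have hex : ∃ B, (pureProb H).IsBasisOf B (rays K) := ⟨B, hB⟩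
  rw [TransitionProbability.probSet, dif_pos hex,
    (hasSum_prob_of_isBasisOf hex.choose_spec σ).tsum_eq]
  exact hasSum_prob_of_isBasisOf hB σ

theorem quad_probSet_rays (K : ∀ α, Submodule ℂ (H α)) [∀ α, CompleteSpace (K α)] (α : ι)
    (v : H α) : quad ((pureProb H).probSet (rays K)) α v = ‖(K α).starProjection v‖ ^ 2 := by
  obtain ⟨B, hB⟩ := exists_isBasisOf_rays K
  by_cases hv : v = 0
  · simp [hv]
  refine HasSum.unique ?_ (hasSum_quad_of_isBasisOf hB α v)
  rw [quad_of_ne _ hv]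
  refine ((hasSum_probSet (isOrthoclosed_rays K) hB _).mul_left (‖v‖ ^ 2)).congr_fun fun e => ?_
  rw [quad_of_ne _ hv]; rfl

end Rays

/-! ### Spectral resolutions -/

section Spectral

variable {ι : Type*} {H : ι → Type*} [∀ α, NormedAddCommGroup (H α)]
  [∀ α, InnerProductSpace ℂ (H α)]

theorem rays_orthogonal {K L : ∀ α, Submodule ℂ (H α)} :
    (∀ ρ ∈ rays K, ∀ σ ∈ rays L, (pureProb H).prob ρ σ = 0) ↔
      ∀ α, ∀ u ∈ K α, ∀ v ∈ L α, inner ℂ u v = 0 := by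
  constructor
  · intro h α u hu v hv
    by_cases hu0 : u = 0
    · rw [hu0, inner_zero_left]
    by_cases hv0 : v = 0
    · rw [hv0, inner_zero_right]
    exact (prob_mk_eq_zero_iff hu0 hv0).1 (h _ ((mk_mem_rays hu0).2 hu) _ ((mk_mem_rays hv0).2 hv))
  · rintro h ⟨α, x⟩ hx ⟨β, y⟩ hy
    by_cases hαβ : α = β
    · subst hαβ
      induction x using Projectivization.ind with
      | h u hu =>
      induction y using Projectivization.ind with
      | h v hv =>
      exact (prob_mk_eq_zero_iff hu hv).2 (h α u ((mk_mem_rays hu).1 hx) v ((mk_mem_rays hv).1 hy))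
    · exact pureProb_of_ne H hαβ _ _

theorem hasSum_quad {J : Type*} {F : J → PureStates H → ℝ} {f : PureStates H → ℝ}
    (h : ∀ σ, HasSum (fun j => F j σ) (f σ)) (α : ι) (v : H α) :
    HasSum (fun j => quad (F j) α v) (quad f α v) := by
  by_cases hv : v = 0
  · subst hv
    simp only [quad_zero_right]
    exact hasSum_zero
  · simp only [quad_of_ne _ hv]
    exact (h _).mul_left _

theorem hasSum_of_quad {J : Type*} {F : J → PureStates H → ℝ} {f : PureStates H → ℝ}
    (h : ∀ α v, HasSum (fun j => quad (F j) α v) (quad f α v)) (σ : PureStates H) :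
    HasSum (fun j => F j σ) (f σ) := by
  simp only [apply_eq_quad_div _ σ]
  exact (h _ _).div_const _

variable [∀ α, CompleteSpace (H α)]

/-- The spectral resolution of a function in `𝔄₀₀` by the eigenspaces of its operators, which are
compact and self-adjoint. It is indexed by all real numbers `t`; the set of rays is empty unless `t`
is an eigenvalue. -/
theorem exists_isSpectralResolution {f : BddFun H} (hf : f ∈ (pureProb H).A00) :
    ∃ Q : ℝ → Set (PureStates H), (pureProb H).IsSpectralResolution f id Q := by
  let K : ℝ → ∀ α, Submodule ℂ (H α) := fun t α =>
    Module.End.eigenspace (op f α : H α →ₗ[ℂ] H α) (t : ℂ)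
  have hop := isOp_op (A00_le_opSpace hf)
  have hmem : ∀ {t α} {v : H α}, v ∈ K t α ↔ op f α v = (t : ℂ) • v :=
    Module.End.mem_eigenspace_iff
  have hK : ∀ t α, CompleteSpace (K t α) := fun t α => by
    have h : IsClosed (K t α : Set (H α)) := by
      have h1 : (K t α : Set (H α)) = {v | op f α v = (t : ℂ) • v} := Set.ext fun v => hmem
      rw [h1]
      exact isClosed_eq (op f α).continuous (continuous_const_smul _)
    exact h.completeSpace_coe
  have horth : ∀ s t, s ≠ t → ∀ α, ∀ u ∈ K s α, ∀ v ∈ K t α, inner ℂ u v = 0 := by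
    intro s t hst α u hu v hv
    have h := (hop α).inner_left u v
    rw [hmem.1 hu, hmem.1 hv, inner_smul_left, inner_smul_right, conj_ofReal] at h
    have h1 : ((s : ℂ) - t) * inner ℂ u v = 0 := by rw [sub_mul, h, sub_self]
    exact (mul_eq_zero.1 h1).resolve_left (sub_ne_zero.2 fun h2 => hst (ofReal_injective h2))
  have htop : ∀ α, (⨆ t, K t α)ᗮ = ⊥ := fun α => by
    have h := ContinuousLinearMap.orthogonalComplement_iSup_eigenspaces_eq_bot
      (isCompactOperator_op hf α) (hop α).isSymmetric
    rw [eq_bot_iff, ← h]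
    refine Submodule.orthogonal_le (iSup_le fun μ => ?_)
    by_cases hμ : Module.End.eigenspace (op f α : H α →ₗ[ℂ] H α) μ = ⊥
    · rw [hμ]; exact bot_le
    -- Eigenvalues of a self-adjoint operator are real.
    · have h1 := (hop α).isSymmetric.conj_eigenvalue_eq_self (Module.End.hasEigenvalue_iff.2 hμ)
      rw [← conj_eq_iff_re.1 h1]
      exact le_iSup (fun t => K t α) μ.re
  have hsum : ∀ α (v : H α), HasSum (fun t => (K t α).starProjection v) v := fun α v =>
    hasSum_starProjection (fun t => K t α) (fun s t hst => horth s t hst α) (htop α) v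
  refine ⟨fun t => rays (K t), fun t => isOrthoclosed_rays _,
    fun s t hst => rays_orthogonal.2 (horth s t hst), ?_, ?_⟩
  · refine hasSum_of_quad (f := fun _ => 1) fun α v => ?_
    simp only [quad_probSet_rays]
    have h1 : quad (fun _ => 1) α v = ‖v‖ ^ 2 := by
      by_cases hv : v = 0
      · simp [hv]
      · rw [quad_of_ne _ hv, mul_one]
    rw [h1]
    exact hasSum_norm_sq_starProjection _ (hsum α v)
  · refine hasSum_of_quad (F := fun t => t • (pureProb H).probSet (rays (K t))) fun α v => ?_
    simp only [quad_smul, quad_probSet_rays]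
    rw [← (hop α).re_inner]
    refine ((((hsum α v).mapL (op f α)).mapL (innerSL ℂ v)).mapL reCLM).congr_fun fun t => ?_
    have hPv := (K t α).starProjection_apply_mem v
    rw [hmem.1 hPv, map_smul, innerSL_apply_apply, smul_eq_mul, reCLM_apply, re_ofReal_mul,
      ← inner_starProjection_self, inner_self_eq_norm_sq_to_K]
    norm_cast

/-- If `f = ∑ⱼ λⱼ p_{Qⱼ}` is a spectral resolution and `T` the operator of `f`, then the vectors in
`Qⱼ` are eigenvectors of `T` with eigenvalue `λⱼ`, by polarization; so the squares `λⱼ²` give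
`‖Tv‖²`, whatever the resolution. -/
theorem hasSum_sq_of_isSpectralResolution {f : BddFun H} (hf : f ∈ opSpace H) {J : Type*}
    {lam : J → ℝ} {Q : J → Set (PureStates H)}
    (h : (pureProb H).IsSpectralResolution f lam Q) (σ : PureStates H) :
    HasSum (fun j => lam j ^ 2 * (pureProb H).probSet (Q j) σ) (jmul f f σ) := by
  choose K hK hQ using fun j => exists_eq_rays (h.orthoclosed j)
  obtain rfl : Q = fun j => rays (K j) := funext hQ
  refine hasSum_of_quad (F := fun j => lam j ^ 2 • (pureProb H).probSet (rays (K j)))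
    (fun α v => ?_) σ
  have hT := isOp_op hf α
  simp only [quad_smul, quad_probSet_rays, quad_jmul_self]
  set T := op f α
  have horth : ∀ i j, i ≠ j → ∀ u ∈ K i α, ∀ v ∈ K j α, inner ℂ u v = 0 := fun i j hij =>
    rays_orthogonal.1 (h.orthogonal i j hij) α
  have h1 : ∀ v : H α, HasSum (fun j => ‖(K j α).starProjection v‖ ^ 2) (‖v‖ ^ 2) := fun v => by
    have h2 := hasSum_quad (f := fun _ => 1) h.hasSum_one α v
    simp only [quad_probSet_rays] at h2
    by_cases hv : v = 0
    · simp only [hv, map_zero, norm_zero, ne_eq, OfNat.ofNat_ne_zero, not_false_eq_true, zero_pow]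
      exact hasSum_zero
    · rwa [quad_of_ne _ hv, mul_one] at h2
  have h2 : ∀ v : H α, HasSum (fun j => lam j * ‖(K j α).starProjection v‖ ^ 2)
      (quad f α v) := fun v => by
    have h3 := hasSum_quad (F := fun j => lam j • (pureProb H).probSet (rays (K j))) h.hasSum α v
    simpa only [quad_smul, quad_probSet_rays] using h3
  have hzero : ∀ i j, i ≠ j → ∀ u ∈ K i α, (K j α).starProjection u = 0 := fun i j hij u hu => by
    rw [Submodule.starProjection_apply_eq_zero_iff, Submodule.mem_orthogonal]
    exact fun w hw => horth j i hij.symm w hw u hu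
  have hquad : ∀ j, ∀ u ∈ K j α, quad f α u = lam j * ‖u‖ ^ 2 := fun j u hu => by
    refine (h2 u).unique ?_
    nth_rw 2 [← Submodule.starProjection_eq_self_iff.2 hu]
    refine hasSum_single j fun i hij => ?_
    rw [hzero j i hij.symm u hu, norm_zero]; ring
  have hre : ∀ i j, ∀ u ∈ K i α, ∀ v ∈ K j α,
      (inner ℂ u (T v)).re = lam j * (inner ℂ u v).re := fun i j u hu v hv => by
    have hp := hT.polar u v
    by_cases hij : i = j
    · subst hij
      have hn : ‖u + v‖ ^ 2 = ‖u‖ ^ 2 + 2 * (inner ℂ u v).re + ‖v‖ ^ 2 := norm_add_sq (𝕜 := ℂ) u v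
      rw [polar, hquad i _ (add_mem hu hv), hquad i u hu, hquad i v hv, hn] at hp
      linarith
    · have hadd : quad f α (u + v) = quad f α u + quad f α v := by
        refine (h2 (u + v)).unique (((h2 u).add (h2 v)).congr_fun fun k => ?_)
        by_cases hk : i = k
        · subst hk
          rw [map_add, hzero j i (Ne.symm hij) v hv, norm_zero, add_zero]; ring
        · rw [map_add, hzero i k hk u hu, norm_zero, zero_add]; ring
      rw [polar, hadd] at hp
      rw [horth i j hij u hu v hv, zero_re]
      linarith
  have hin : ∀ i j, ∀ u ∈ K i α, ∀ v ∈ K j α,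
      inner ℂ u (T v) = lam j * inner ℂ u v := fun i j u hu v hv => by
    have h3 := hre i j u hu v hv
    have h4 := hre i j u hu (I • v) ((K j α).smul_mem I hv)
    rw [map_smul, inner_smul_right, inner_smul_right, I_mul_re, I_mul_re] at h4
    apply Complex.ext
    · rw [h3, re_ofReal_mul]
    · rw [im_ofReal_mul]; linarith
  -- `Tu - λⱼu` is orthogonal to all `K i α`, whose projections add up to the identity.
  have heig : ∀ j, ∀ u ∈ K j α, T u = (lam j : ℂ) • u := fun j u hu => by
    rw [← sub_eq_zero, ← norm_eq_zero, ← sq_eq_zero_iff]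
    refine (h1 _).unique ?_
    refine hasSum_zero.congr_fun fun i => ?_
    rw [sq_eq_zero_iff, norm_eq_zero, Submodule.starProjection_apply_eq_zero_iff,
      Submodule.mem_orthogonal]
    intro w hw
    rw [inner_sub_right, inner_smul_right, hin i j w hw u hu, sub_self]
  have hproj : ∀ j, (K j α).starProjection (T v) = (lam j : ℂ) • (K j α).starProjection v :=
    fun j => by
      refine Submodule.eq_starProjection_of_mem_of_inner_eq_zero
        ((K j α).smul_mem _ ((K j α).starProjection_apply_mem v)) fun w hw => ?_
      have h3 := (K j α).starProjection_inner_eq_zero v w hw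
      rw [inner_sub_left, sub_eq_zero] at h3
      rw [inner_sub_left, hT.inner_left, heig j w hw, inner_smul_left, inner_smul_right, ← h3,
        conj_ofReal, sub_self]
  refine (h1 (T v)).congr_fun fun j => ?_
  rw [hproj, norm_smul, norm_real, mul_pow, Real.norm_eq_abs, sq_abs]

end Spectral

/-! ### Polarization, continuity and density -/

section Products

theorem IsJordanProduct.polarization {V : Type*} [AddCommGroup V] [Module ℝ V] {mul : V → V → V}
    (h : IsJordanProduct mul) (a b : V) :
    mul a b = (1 / 4 : ℝ) • (mul (a + b) (a + b) - mul (a - b) (a - b)) := by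
  have hr : ∀ x y z, mul x (y + z) = mul x y + mul x z := fun x y z => by
    rw [h.comm, h.add_left, h.comm y, h.comm z]
  have hn : ∀ x y, mul (-x) y = -mul x y := fun x y => by
    rw [← neg_one_smul ℝ x, h.smul_left, neg_one_smul]
  have hn' : ∀ x y, mul x (-y) = -mul x y := fun x y => by rw [h.comm, hn, h.comm]
  rw [sub_eq_add_neg a b]
  simp only [h.add_left, hr, hn, hn', h.comm b a]
  module

variable {ι : Type*} {H : ι → Type*} [∀ α, NormedAddCommGroup (H α)]
  [∀ α, InnerProductSpace ℂ (H α)]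

theorem continuous_subMul {W : Submodule ℝ (BddFun H)} (hV : W ≤ opSpace H)
    (hW : ∀ f ∈ W, ∀ g ∈ W, jmul f g ∈ W) : Continuous (Function.uncurry (subMul hW)) :=
  (continuousOn_jmul.comp_continuous (f := fun x : W × W => ((x.1 : BddFun H), (x.2 : BddFun H)))
    (by fun_prop) fun x => ⟨hV x.1.2, hV x.2.2⟩).subtype_mk _

theorem denseRange_inclA0 : DenseRange (pureProb H).inclA0 := by
  intro f
  rw [closure_subtype, ← Set.range_comp]
  have h : (Subtype.val ∘ (pureProb H).inclA0 : (pureProb H).A00 → BddFun H) = Subtype.val := rfl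
  rw [h, Subtype.range_coe]
  exact f.2

end Products

end TPS

end

theorem proposition3p3 {ι : Type*} (H : ι → Type*) [∀ α, NormedAddCommGroup (H α)]
    [∀ α, InnerProductSpace ℂ (H α)] [∀ α, CompleteSpace (H α)] :
    -- the functions `p_Q` do not depend on the choice of a basis of `Q`
    (∀ Q : Set (TPS.PureStates H), (TPS.pureProb H).IsOrthoclosed Q →
      (∃ B, (TPS.pureProb H).IsBasisOf B Q) ∧
      ∀ B, (TPS.pureProb H).IsBasisOf B Q → ∀ σ,
        HasSum (fun e : B => (TPS.pureProb H).prob e σ) ((TPS.pureProb H).probSet Q σ)) ∧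
    -- the elements of `𝔄₀₀` have spectral resolutions
    (∀ f : (TPS.pureProb H).A00, ∃ (J : Type) (lam : J → ℝ) (Q : J → Set (TPS.PureStates H)),
      (TPS.pureProb H).IsSpectralResolution f.1 lam Q) ∧
    -- squaring on `𝔄₀₀` is well defined by spectral resolutions
    ∃ sq : (TPS.pureProb H).A00 → (TPS.pureProb H).A00,
      (∀ (f : (TPS.pureProb H).A00) (J : Type*) (lam : J → ℝ)
        (Q : J → Set (TPS.PureStates H)),
        (TPS.pureProb H).IsSpectralResolution f.1 lam Q →
        ∀ σ, HasSum (fun j => lam j ^ 2 * (TPS.pureProb H).probSet (Q j) σ) ((sq f).1 σ)) ∧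
      ∃ mul₀₀ : (TPS.pureProb H).A00 → (TPS.pureProb H).A00 → (TPS.pureProb H).A00,
        (∀ f g, mul₀₀ f g = (1 / 4 : ℝ) • (sq (f + g) - sq (f - g))) ∧
        (∀ f, mul₀₀ f f = sq f) ∧
        TPS.IsJordanProduct mul₀₀ ∧
        -- the norm continuous extension to `𝔄₀`
        ∃ mul₀ : (TPS.pureProb H).A0 → (TPS.pureProb H).A0 → (TPS.pureProb H).A0,
          (Continuous (Function.uncurry mul₀) ∧
            ∀ f g, mul₀ ((TPS.pureProb H).inclA0 f) ((TPS.pureProb H).inclA0 g) =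
              (TPS.pureProb H).inclA0 (mul₀₀ f g)) ∧
          (∀ mul' : (TPS.pureProb H).A0 → (TPS.pureProb H).A0 → (TPS.pureProb H).A0,
            Continuous (Function.uncurry mul') →
            (∀ f g, mul' ((TPS.pureProb H).inclA0 f) ((TPS.pureProb H).inclA0 g) =
              (TPS.pureProb H).inclA0 (mul₀₀ f g)) →
            mul' = mul₀) ∧
          TPS.IsJBProduct mul₀ ∧
          -- the weak-star continuous extension to the double dual `𝔄`
          ∃ mul : (TPS.pureProb H).ABidual → (TPS.pureProb H).ABidual →
              (TPS.pureProb H).ABidual,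
            (TPS.SeparatelyWeakStarContinuous mul ∧
              ∀ f g, mul ((TPS.pureProb H).inclBidual f) ((TPS.pureProb H).inclBidual g) =
                (TPS.pureProb H).inclBidual (mul₀ f g)) ∧
            (∀ mul' : (TPS.pureProb H).ABidual → (TPS.pureProb H).ABidual →
                (TPS.pureProb H).ABidual,
              TPS.SeparatelyWeakStarContinuous mul' →
              (∀ f g, mul' ((TPS.pureProb H).inclBidual f) ((TPS.pureProb H).inclBidual g) =
                (TPS.pureProb H).inclBidual (mul₀ f g)) →
              mul' = mul) ∧
            TPS.IsJBProduct mul := by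
  set p := TPS.pureProb H
  have hA := TPS.A00_le_opSpace (H := H)
  have hm00 : ∀ f ∈ p.A00, ∀ g ∈ p.A00, TPS.jmul f g ∈ p.A00 := fun f hf g hg =>
    TPS.jmul_mem_A00 hf (hA hg)
  have hm0 : ∀ f ∈ p.A0, ∀ g ∈ p.A0, TPS.jmul f g ∈ p.A0 := fun f hf g hg =>
    TPS.jmul_mem_A0 hf hg
  have hJ00 := TPS.isJordanProduct_subMul hA hm00
  have hJB := TPS.isJBProduct_subMul TPS.A0_le_opSpace hm0 p.A00.isClosed_topologicalClosure
  have hJ : Set.range p.A0.subtypeₗᵢ = (p.A0 : Set (TPS.BddFun H)) := Subtype.range_coe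
  have hcont : Continuous (Function.uncurry (TPS.subMul hm0)) := TPS.continuous_subMul
    TPS.A0_le_opSpace hm0
  refine ⟨fun Q hQ => ⟨?_, fun B hB σ => TPS.hasSum_probSet hQ hB σ⟩, fun f => ?_,
    fun f => TPS.subMul hm00 f f, fun f J lam Q h σ =>
      TPS.hasSum_sq_of_isSpectralResolution (hA f.2) h σ,
    TPS.subMul hm00, fun f g => ?_, fun f => rfl, hJ00, TPS.subMul hm0, ⟨hcont, fun f g => rfl⟩,
    fun m hm h => ?_, hJB, TPS.bidualMul hJ,
    ⟨TPS.separatelyWeakStarContinuous_bidualMul hJ, fun f g => TPS.bidualMul_inclusion hJ rfl⟩,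
    fun m hm h => TPS.eq_of_separatelyWeakStarContinuous hJ hm
      (TPS.separatelyWeakStarContinuous_bidualMul hJ) fun a b =>
        (h a b).trans (TPS.bidualMul_inclusion hJ rfl).symm,
    TPS.isJBProduct_bidualMul hJ⟩
  · obtain ⟨K, _, rfl⟩ := TPS.exists_eq_rays hQ
    exact TPS.exists_isBasisOf_rays K
  · obtain ⟨Q, hQ⟩ := TPS.exists_isSpectralResolution f.2
    exact ⟨ℝ, id, Q, hQ⟩
  · exact hJ00.polarization f g
  · have hd : DenseRange (Prod.map p.inclA0 p.inclA0) :=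
      TPS.denseRange_inclA0.prodMap TPS.denseRange_inclA0
    have h1 : Function.uncurry m = Function.uncurry (TPS.subMul hm0) :=
      hd.equalizer hm hcont (funext fun x => h x.1 x.2)
    exact Function.uncurry_injective h1
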